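/- Let the helix-3-graph be the graph with vertex set $\mathbb Z$ and edges $h_m=\{m-3,m\}$, $z_m=\{m-1,m\}$, $m\in\mathbb Z$, and let $\gamma=(1+\sqrt5)/2$. A set $t$ of edges is identified with an element of $(\{0,1\}^2)^{\mathbb Z}$ via $t\mapsto(\mathbf 1_t(h_m),\mathbf 1_t(z_m))_{m\in\mathbb Z}$. Let $\mathbf P$ be the uniform spanning tree measure, that is, the weak limit as $n\to\infty$ of the uniform distributions on the spanning trees of the subgraphs induced by $\{-n,\ldots,n\}$. This limit exists and is a probability measure concentrated on the spanning trees of the helix-3-graph. For a spanning tree $t$ and $n\in\mathbb Z$, the restriction of $t$ to the vertices $\{n,n-1,n-2,\ldots\}$ is a spanning forest each of whose components contains at least one of the points $n,n-1,n-2$. Its type $i(t,n)\in\{1,\ldots,5\}$ is defined by how these three points are distributed over the components: type 1: all three in one component; type 2: $n$ in one component, $n-1,n-2$ in another; type 3: $n-2$ in one component, $n,n-1$ in another; type 4: $n-1$ in one component, $n,n-2$ in another; type 5: three different components. For every spanning tree $t$ and every $n$, the triple $(\mathbf 1_t(h_n),\mathbf 1_t(z_n),i(t,n))$ is one of the eleven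 symbols $$\delta_1=(0,1,1),\ \delta_2=(1,0,1),\ \delta_3=(1,1,1),\ \delta_4=(0,0,2),\ \delta_5=(1,0,2),\ \delta_6=(0,1,3),$$ $$\delta_7=(1,0,3),\ \delta_8=(1,1,3),\ \delta_9=(1,0,4),\ \delta_{10}=(0,0,5),\ \delta_{11}=(1,0,5).$$ Denote this triple by $Y_n(t)$. Then, under $\mathbf P$, the process $Y=(Y_n)_{n\in\mathbb Z}$ is a stationary Markov chain on $\{\delta_1,\ldots,\delta_{11}\}$ with transition matrix $R=(R_{i,j})_{i,j=1,\ldots,11}$, whose non-zero entries are $$\begin{aligned} &R_{i,1}=R_{i,2}=\tfrac12\bar R_{1,1},\quad R_{i,4}=\bar R_{1,2}&&(i=1,2,3),\\ &R_{i,3}=\bar R_{2,1},\quad R_{i,6}=\bar R_{2,3},\quad R_{i,9}=\bar R_{2,4},\quad R_{i,10}=\bar R_{2,5}&&(i=4,5),\\ &R_{i,3}=\bar R_{3,1},\quad R_{i,5}=\bar R_{3,2}&&(i=6,7,8),\\ &R_{9,6}=R_{9,7}=\tfrac12\bar R_{4,3},\quad R_{9,10}=\bar R_{4,5},\\ &R_{i,8}=\bar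 R_{5,3},\quad R_{i,11}=\bar R_{5,5}&&(i=10,11), \end{aligned}$$ where $$\begin{aligned} &\bar R_{1,1}=2(\gamma-\sqrt\gamma),\quad \bar R_{1,2}=1-2(\gamma-\sqrt\gamma),\\ &\bar R_{2,1}=\frac{\sqrt\gamma}{2+\sqrt\gamma},\quad \bar R_{2,3}=\frac{\gamma-1/\sqrt\gamma}{2+\sqrt\gamma},\quad \bar R_{2,4}=\frac{2-\sqrt\gamma}{2+\sqrt\gamma},\quad \bar R_{2,5}=\frac{\sqrt\gamma+1/\sqrt\gamma-\gamma}{2+\sqrt\gamma},\\ &\bar R_{3,1}=\frac{\gamma^{3/2}-1}2,\quad \bar R_{3,2}=\frac{3-\gamma^{3/2}}2,\\ &\bar R_{4,3}=\frac{2\sqrt5\,\gamma-2\gamma^{5/2}}{2-\sqrt\gamma},\quad \bar R_{4,5}=\frac{2-\sqrt\gamma-2\sqrt5\,\gamma+2\gamma^{5/2}}{2-\sqrt\gamma},\\ &\bar R_{5,3}=1-\frac1{\gamma+\sqrt\gamma},\quad \bar R_{5,5}=\frac1{\gamma+\sqrt\gamma}. \end{aligned}$$ The invariant distribution of $R$ is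 unique, it is the law of each $Y_n$, and it equals $$\begin{aligned}\pi^R=\frac1{4\sqrt5}\Big(&\gamma,\ \gamma,\ \gamma^{3/2}-\gamma^{-1},\ \gamma^{3/2}-\gamma^{-1},\ 3\gamma^{-1}-\gamma^{1/2},\ 2\gamma-2\gamma^{1/2},\ \sqrt5-\gamma^{3/2},\\&\sqrt5\,\gamma^{3/2}-\gamma^3,\ 2\gamma^{-1}-\gamma^{-1/2},\ \sqrt5\,\gamma^{3/2}-\gamma^3,\ \gamma^4-2\gamma^{5/2}\Big).\end{aligned}$$ The entropy $H^R=-\sum_{i,j=1}^{11}\pi^R_iR_{i,j}\log R_{i,j}$ of the chain (with $0\log0=0$) is $$H^R=\log\big(\gamma+\sqrt\gamma\big).$$ -/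

import Mathlib

open MeasureTheory Set

namespace HelixUST

/-! ## Configurations and spanning trees of the helix-3-graph -/

/-- The configuration space `({0,1} × {0,1})^ℤ`.  A configuration `t` stands for the set of edges
of the helix-3-graph that contains `h_j = {j - 3, j}` iff `(t j).1 = true`
and `z_j = {j - 1, j}` iff `(t j).2 = true`.  It carries the product topology and the
product σ-algebra. -/
abbrev Config : Type := ℤ → Bool × Bool

/-- The edge set that a configuration stands for. -/
def edges (t : Config) : Set (Sym2 ℤ) :=
  {e | ∃ j : ℤ, ((t j).1 = true ∧ e = s(j - 3, j)) ∨ ((t j).2 = true ∧ e = s(j - 1, j))}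

/-- The graph on the vertex set `ℤ` whose edges are those of the configuration `t`. -/
def graph (t : Config) : SimpleGraph ℤ := SimpleGraph.fromEdgeSet (edges t)

/-- The helix-3-graph itself: all edges `h_j` and `z_j`, `j ∈ ℤ`. -/
def helixGraph : SimpleGraph ℤ := graph fun _ => (true, true)

/-- The set of spanning trees of the subgraph of the helix-3-graph induced by `{m, …, n}`:
only edges with both end points in `{m, …, n}` are used, and they form a tree on `{m, …, n}`. -/
def finiteSpanningTrees (m n : ℤ) : Set Config :=
  {t | (∀ e ∈ edges t, ∀ v ∈ e, v ∈ Icc m n) ∧ ((graph t).induce (Icc m n)).IsTree}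

/-- The set of spanning trees of the (infinite) helix-3-graph. -/
def spanningTrees : Set Config := {t | (graph t).IsTree}

theorem finiteSpanningTrees_finite (m n : ℤ) : (finiteSpanningTrees m n).Finite := by
  have hfin : (Set.pi Set.univ fun j : ℤ =>
      if j ∈ Icc m n then (Set.univ : Set (Bool × Bool)) else {(false, false)}).Finite := by
    have hsub : (Set.pi Set.univ fun j : ℤ =>
        if j ∈ Icc m n then (Set.univ : Set (Bool × Bool)) else {(false, false)}) ⊆
        Set.range fun (g : Icc m n → Bool × Bool) (j : ℤ) =>
          if h : j ∈ Icc m n then g ⟨j, h⟩ else (false, false) := by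
      intro t ht
      refine ⟨fun j => t j, ?_⟩
      funext j
      have := ht j (Set.mem_univ j)
      by_cases h : j ∈ Icc m n
      · simp only [dif_pos h]
      · simp only [if_neg h, Set.mem_singleton_iff] at this
        simp only [dif_neg h, this]
    exact (Set.finite_range _).subset hsub
  refine hfin.subset ?_
  intro t ht j _
  by_cases h : j ∈ Icc m n
  · simp [h]
  · simp only [if_neg h, Set.mem_singleton_iff]
    have h1 : (t j).1 ≠ true := fun h1 =>
      h (ht.1 _ ⟨j, Or.inl ⟨h1, rfl⟩⟩ j (Sym2.mem_mk_right _ _))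
    have h2 : (t j).2 ≠ true := fun h2 =>
      h (ht.1 _ ⟨j, Or.inr ⟨h2, rfl⟩⟩ j (Sym2.mem_mk_right _ _))
    ext <;> simp_all

theorem helixGraph_induce_connected (m n : ℤ) (hmn : m ≤ n) :
    (helixGraph.induce (Icc m n)).Connected := by
  have key : ∀ k : ℕ, ∀ h : m + k ∈ Icc m n,
      (helixGraph.induce (Icc m n)).Reachable ⟨m, ⟨le_rfl, hmn⟩⟩ ⟨m + k, h⟩ := by
    intro k
    induction k with
    | zero => intro h; simp only [Nat.cast_zero, add_zero]; exact SimpleGraph.Reachable.refl _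
    | succ k ih =>
      intro h
      have h' : m + (k : ℤ) ∈ Icc m n := ⟨by omega, by have := h.2; push_cast at this; omega⟩
      refine (ih h').trans (SimpleGraph.Adj.reachable ?_)
      simp only [SimpleGraph.comap_adj, Function.Embedding.subtype_apply, helixGraph, graph,
        SimpleGraph.fromEdgeSet_adj]
      refine ⟨⟨m + (k : ℤ) + 1, Or.inr ⟨rfl, ?_⟩⟩, by push_cast; omega⟩
      push_cast
      congr 1 <;> ring
  have : Nonempty (Icc m n) := ⟨⟨m, ⟨le_rfl, hmn⟩⟩⟩
  have key' : ∀ v : Icc m n,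
      (helixGraph.induce (Icc m n)).Reachable ⟨m, ⟨le_rfl, hmn⟩⟩ v := by
    rintro ⟨v, hv⟩
    obtain ⟨k, hk⟩ := Int.eq_ofNat_of_zero_le (sub_nonneg.2 hv.1)
    obtain rfl : v = m + k := by simp only [← hk]; ring
    exact key k hv
  exact ⟨fun u v => (key' u).symm.trans (key' v)⟩

theorem finiteSpanningTrees_nonempty (m n : ℤ) (hmn : m ≤ n) :
    (finiteSpanningTrees m n).Nonempty := by
  classical
  obtain ⟨T, hle, hT⟩ := (helixGraph_induce_connected m n hmn).exists_isTree_le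
  let S : SimpleGraph ℤ := T.map (Function.Embedding.subtype _)
  have hS : ∀ a b, S.Adj a b ↔ ∃ (ha : a ∈ Icc m n) (hb : b ∈ Icc m n), T.Adj ⟨a, ha⟩ ⟨b, hb⟩ := by
    intro a b
    simp only [S, SimpleGraph.map_adj, Function.Embedding.subtype_apply]
    constructor
    · rintro ⟨u, v, h, rfl, rfl⟩; exact ⟨u.2, v.2, h⟩
    · rintro ⟨ha, hb, h⟩; exact ⟨_, _, h, rfl, rfl⟩
  let t : Config := fun j => (decide (S.Adj (j - 3) j), decide (S.Adj (j - 1) j))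
  have hadj : ∀ a b, (graph t).Adj a b ↔ S.Adj a b := by
    intro a b
    simp only [graph, SimpleGraph.fromEdgeSet_adj, edges, Set.mem_ofPred_eq, t, decide_eq_true_eq]
    constructor
    · rintro ⟨⟨j, ⟨h, he⟩ | ⟨h, he⟩⟩, -⟩
      all_goals
        rcases Sym2.eq_iff.1 he with ⟨rfl, rfl⟩ | ⟨rfl, rfl⟩
        · exact h
        · exact h.symm
    · intro h
      refine ⟨?_, h.ne⟩
      obtain ⟨ha, hb, hab⟩ := (hS a b).1 h
      have h0 := hle hab
      simp only [SimpleGraph.comap_adj, Function.Embedding.subtype_apply, helixGraph, graph,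
        SimpleGraph.fromEdgeSet_adj, edges, Set.mem_ofPred_eq, true_and] at h0
      obtain ⟨⟨j, he | he⟩, -⟩ := h0
      · refine ⟨j, Or.inl ⟨?_, he⟩⟩
        rcases Sym2.eq_iff.1 he with ⟨rfl, rfl⟩ | ⟨rfl, rfl⟩
        · exact h
        · exact h.symm
      · refine ⟨j, Or.inr ⟨?_, he⟩⟩
        rcases Sym2.eq_iff.1 he with ⟨rfl, rfl⟩ | ⟨rfl, rfl⟩
        · exact h
        · exact h.symm
  refine ⟨t, ?_, ?_⟩
  · rintro e ⟨j, ⟨h, rfl⟩ | ⟨h, rfl⟩⟩ v hv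
    all_goals
      simp only [t, decide_eq_true_eq] at h
      obtain ⟨ha, hb, -⟩ := (hS _ _).1 h
      rcases Sym2.mem_iff.1 hv with rfl | rfl
      · exact ha
      · exact hb
  · have : (graph t).induce (Icc m n) = T := by
      ext a b
      simp only [SimpleGraph.comap_adj, Function.Embedding.subtype_apply, hadj, hS]
      exact ⟨fun ⟨_, _, h⟩ => h, fun h => ⟨a.2, b.2, h⟩⟩
    rw [this]; exact hT

/-! ## The uniform spanning tree measure -/

/-- `P_n`, the uniform distribution on the spanning trees of the subgraph induced by
`{-n, …, n}`. -/
noncomputable def finiteUST (n : ℕ) : ProbabilityMeasure Config :=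
  ⟨ProbabilityTheory.uniformOn (finiteSpanningTrees (-n) n),
    ProbabilityTheory.isProbabilityMeasure_uniformOn (finiteSpanningTrees_finite _ _)
      (finiteSpanningTrees_nonempty _ _ (by omega))⟩

/-- `P` is the uniform spanning tree measure of the helix-3-graph: the weak limit of the `P_n`. -/
def IsUST (P : ProbabilityMeasure Config) : Prop :=
  Filter.Tendsto finiteUST Filter.atTop (nhds P)

/-! ## Forest types and the encoding -/

/-- The restriction of `t` to the vertices `{n, n - 1, n - 2, …}`. -/
abbrev leftGraph (t : Config) (n : ℤ) : SimpleGraph (Iic n) := (graph t).induce (Iic n)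

/-- The vertices `a` and `b` (both at most `n`) lie in the same connected component of the
restriction of `t` to `{n, n - 1, …}`. -/
def SameComponent (t : Config) (n a b : ℤ) : Prop :=
  ∃ (ha : a ∈ Iic n) (hb : b ∈ Iic n), (leftGraph t n).Reachable ⟨a, ha⟩ ⟨b, hb⟩

/-- How the three rightmost points `n, n - 1, n - 2` are distributed over the components, for
the five types of forests (type `k` is represented by `k - 1 : Fin 5`):
type 1: all in one component; type 2: `n | n-1, n-2`; type 3: `n-2 | n, n-1`;
type 4: `n-1 | n, n-2`; type 5: three different components. -/
def ConnectionPattern (t : Config) (n : ℤ) : Fin 5 → Prop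
  | 0 => SameComponent t n n (n - 1) ∧ SameComponent t n (n - 1) (n - 2)
  | 1 => ¬ SameComponent t n n (n - 1) ∧ SameComponent t n (n - 1) (n - 2)
  | 2 => SameComponent t n n (n - 1) ∧ ¬ SameComponent t n (n - 1) (n - 2)
  | 3 => ¬ SameComponent t n n (n - 1) ∧ SameComponent t n n (n - 2)
  | 4 => ¬ SameComponent t n n (n - 1) ∧ ¬ SameComponent t n (n - 1) (n - 2) ∧
      ¬ SameComponent t n n (n - 2)

/-- `Gamma n i` is the set of the configurations whose restriction to `{n, n - 1, …}` is a
spanning forest of type `i`: it has no cycles, each of its components contains at least one of the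
points `n, n - 1, n - 2`, and these are distributed over the components as the type says. -/
def Gamma (n : ℤ) (i : Fin 5) : Set Config :=
  {t | (leftGraph t n).IsAcyclic ∧
    (∀ v ≤ n, SameComponent t n v n ∨ SameComponent t n v (n - 1) ∨ SameComponent t n v (n - 2)) ∧
    ConnectionPattern t n i}

open Classical in
/-- The type `i(t, n)`, that is, the `i` with `t ∈ Gamma n i` (arbitrary if there is none, which
does not happen for a spanning tree). -/
noncomputable def forestType (t : Config) (n : ℤ) : Fin 5 :=
  if h : ∃ i, t ∈ Gamma n i then h.choose else 0

/-- `φ_n(t) = (1_t(h_n), 1_t(z_n), i(t, n))`. -/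
noncomputable def code (n : ℤ) (t : Config) : Bool × Bool × Fin 5 :=
  ((t n).1, (t n).2, forestType t n)

/-- The eleven symbols `δ_1, …, δ_11` (`δ_k` is `symbol (k - 1)`; in the third entry, the
type `i` is written `i - 1`). -/
def symbol : Fin 11 → Bool × Bool × Fin 5 :=
  ![(false, true, 0), (true, false, 0), (true, true, 0),
    (false, false, 1), (true, false, 1),
    (false, true, 2), (true, false, 2), (true, true, 2),
    (true, false, 3),
    (false, false, 4), (true, false, 4)]

/-- The process `Y`: `Y n t` is the index of the symbol `φ_n(t)`. -/
noncomputable def Y (n : ℤ) (t : Config) : Fin 11 := Function.invFun symbol (code n t)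

/-! ## Markov chains -/

/-- The process `X`, indexed by `ℤ`, with values in the finite set `S`, is a stationary Markov
chain under `P` with transition matrix `R`. -/
structure IsStationaryMarkovChain {Ω S : Type*} [MeasurableSpace Ω] [MeasurableSpace S]
    [Fintype S] [DecidableEq S] (P : Measure Ω) (X : ℤ → Ω → S) (R : Matrix S S ℝ) : Prop where
  /-- The process consists of random variables. -/
  measurable : ∀ n, Measurable (X n)
  /-- The matrix is stochastic. -/
  stochastic : R ∈ Matrix.rowStochastic ℝ S
  /-- The law of the process is invariant under shifts. -/
  stationary : ∀ k : ℤ,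
    P.map (fun ω (n : ℤ) => X (n + k) ω) = P.map (fun ω (n : ℤ) => X n ω)
  /-- The Markov property
  `P(X_{n+1} = j | X_n = s_0, X_{n-1} = s_1, …, X_{n-k} = s_k) = R(s_0, j)`, multiplied by the
  probability of the condition. -/
  markov : ∀ (n : ℤ) (k : ℕ) (s : ℕ → S) (j : S),
    P.real {ω | X (n + 1) ω = j ∧ ∀ i : ℕ, i ≤ k → X (n - i) ω = s i} =
      P.real {ω | ∀ i : ℕ, i ≤ k → X (n - i) ω = s i} * R (s 0) j

/-- The entropy of the stationary Markov chain with transition matrix `R` and invariant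
distribution `ν` (with `0 log 0 = 0`). -/
noncomputable def chainEntropy {S : Type*} [Fintype S] (ν : S → ℝ) (R : Matrix S S ℝ) : ℝ :=
  -∑ i, ∑ j, ν i * R i j * Real.log (R i j)

/-! ## The explicit transition matrix and invariant distribution -/

/-- The golden ratio `(√5 + 1) / 2`. -/
noncomputable abbrev γ : ℝ := Real.goldenRatio

/-- The transition probabilities between the five forest types. -/
noncomputable def typeMatrix : Matrix (Fin 5) (Fin 5) ℝ :=
  !![2 * (γ - √γ), 1 - 2 * (γ - √γ), 0, 0, 0;
     √γ / (2 + √γ), 0, (γ - 1 / √γ) / (2 + √γ), (2 - √γ) / (2 + √γ),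
       (√γ + 1 / √γ - γ) / (2 + √γ);
     (γ ^ (3 / 2 : ℝ) - 1) / 2, (3 - γ ^ (3 / 2 : ℝ)) / 2, 0, 0, 0;
     0, 0, (2 * √5 * γ - 2 * γ ^ (5 / 2 : ℝ)) / (2 - √γ), 0,
       (2 - √γ - 2 * √5 * γ + 2 * γ ^ (5 / 2 : ℝ)) / (2 - √γ);
     0, 0, 1 - 1 / (γ + √γ), 0, 1 / (γ + √γ)]

/-- The transition matrix `R` of the process `Y`. -/
noncomputable def R : Matrix (Fin 11) (Fin 11) ℝ :=
  let r11 := typeMatrix 0 0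
  let r12 := typeMatrix 0 1
  let r21 := typeMatrix 1 0
  let r23 := typeMatrix 1 2
  let r24 := typeMatrix 1 3
  let r25 := typeMatrix 1 4
  let r31 := typeMatrix 2 0
  let r32 := typeMatrix 2 1
  let r43 := typeMatrix 3 2
  let r45 := typeMatrix 3 4
  let r53 := typeMatrix 4 2
  let r55 := typeMatrix 4 4
  !![r11 / 2, r11 / 2, 0, r12, 0, 0, 0, 0, 0, 0, 0;
     r11 / 2, r11 / 2, 0, r12, 0, 0, 0, 0, 0, 0, 0;
     r11 / 2, r11 / 2, 0, r12, 0, 0, 0, 0, 0, 0, 0;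
     0, 0, r21, 0, 0, r23, 0, 0, r24, r25, 0;
     0, 0, r21, 0, 0, r23, 0, 0, r24, r25, 0;
     0, 0, r31, 0, r32, 0, 0, 0, 0, 0, 0;
     0, 0, r31, 0, r32, 0, 0, 0, 0, 0, 0;
     0, 0, r31, 0, r32, 0, 0, 0, 0, 0, 0;
     0, 0, 0, 0, 0, r43 / 2, r43 / 2, 0, 0, r45, 0;
     0, 0, 0, 0, 0, 0, 0, r53, 0, 0, r55;
     0, 0, 0, 0, 0, 0, 0, r53, 0, 0, r55]

/-- The invariant distribution of `R`. -/
noncomputable def invDist : Fin 11 → ℝ := fun k =>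
  1 / (4 * √5) *
    ![γ, γ,
      γ ^ (3 / 2 : ℝ) - γ⁻¹,
      γ ^ (3 / 2 : ℝ) - γ⁻¹,
      3 * γ⁻¹ - √γ,
      2 * γ - 2 * √γ,
      √5 - γ ^ (3 / 2 : ℝ),
      √5 * γ ^ (3 / 2 : ℝ) - γ ^ 3,
      2 * γ⁻¹ - 1 / √γ,
      √5 * γ ^ (3 / 2 : ℝ) - γ ^ 3,
      γ ^ 4 - 2 * γ ^ (5 / 2 : ℝ)] k

end HelixUST

/-! A forest on `{…, n}` is extended by the vertex `n + 1` through at most two edges, to `n` and to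
`n - 2`. Whether the result is again a forest all of whose components meet the last three vertices,
and which type it then has, depends only on the old type and on the two edges (`forestOn_insert`,
`step`). So the spanning trees of a finite piece are the paths of an automaton with five states that
end in type 1 (index `0`), and the eleven symbols label its legal transitions.

Counting trees with prescribed symbols in a window becomes multiplying transfer matrices
(`ncard_forests`). The full matrix `typeCount univ` is primitive, with Perron root `lam = γ + √γ`
and positive eigenvectors `rv`, `lv`; its normalized powers tend to the rank-one matrix `rv lvᵀ`
(`tendsto_pow_of_primitive`). Hence the finite-volume probabilities converge to `boxProb`, and by
compactness these numbers are the box probabilities of a measure `Q` on symbol sequences. Forgetting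
the types (`decode`) maps `Q` to the uniform spanning tree measure (`isUST_map`).

The explicit matrix `R` is the Doob transform of the automaton: a legal transition from type `i` to
type `j` has probability `rv j / (lam * rv i)` (`R_apply`). So `Q` is the Parry measure of the
automaton. The Markov property, the unique invariant law and the entropy `log lam` all follow from
the eigenvector equations and primitivity.

It remains to see that the types can be read off the infinite tree, that is, that `Y` inverts
`decode` almost surely. Two consecutive symbols `δ₁` at `j - 1` and `j` put a path on `j - 2, j - 1,
j`, which fixes the type at `j` whatever lies further to the left. This pattern recurs almost surely
in both directions (`IsSymbolLaw.ae_renewal`). Far to the left it determines the types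
(`forestOn_decode`); far to the right it joins all components into one tree
(`decode_mem_spanningTrees`). Therefore `Y` has the law `Q`. -/

namespace HelixUST

/-! ### Connections and cycles inside a set of vertices -/

section Reachability

variable {V : Type*} {G : SimpleGraph V} {S T : Set V} {a b c : V}

/-- `a` and `b` lie in `S` and are joined by a walk of `G` inside `S`. -/
def ReachIn (G : SimpleGraph V) (S : Set V) (a b : V) : Prop :=
  a ∈ S ∧ Relation.ReflTransGen (fun x y => G.Adj x y ∧ x ∈ S ∧ y ∈ S) a b

theorem ReachIn.refl (h : a ∈ S) : ReachIn G S a a := ⟨h, .refl⟩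

theorem ReachIn.right_mem (h : ReachIn G S a b) : b ∈ S := by
  obtain ⟨ha, h⟩ := h
  induction h with
  | refl => exact ha
  | tail _ h _ => exact h.2.2

theorem ReachIn.trans (h : ReachIn G S a b) (h' : ReachIn G S b c) : ReachIn G S a c :=
  ⟨h.1, h.2.trans h'.2⟩

theorem ReachIn.symm (h : ReachIn G S a b) : ReachIn G S b a := by
  refine ⟨h.right_mem, ?_⟩
  have h2 := h.2
  clear h
  induction h2 with
  | refl => exact .refl
  | tail _ h ih => exact .head ⟨h.1.symm, h.2.2, h.2.1⟩ ih

theorem reachIn_comm : ReachIn G S a b ↔ ReachIn G S b a := ⟨.symm, .symm⟩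

theorem ReachIn.of_adj (h : G.Adj a b) (ha : a ∈ S) (hb : b ∈ S) : ReachIn G S a b :=
  ⟨ha, .single ⟨h, ha, hb⟩⟩

theorem ReachIn.mono {H : SimpleGraph V}
    (hGH : ∀ x ∈ S, ∀ y ∈ S, G.Adj x y → H.Adj x y) (hST : S ⊆ T)
    (h : ReachIn G S a b) : ReachIn H T a b :=
  ⟨hST h.1, Relation.ReflTransGen.mono
    (fun _ _ h => ⟨hGH _ h.2.1 _ h.2.2 h.1, hST h.2.1, hST h.2.2⟩) _ _ h.2⟩

theorem reachIn_iff_induce :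
    ReachIn G S a b ↔ ∃ (ha : a ∈ S) (hb : b ∈ S), (G.induce S).Reachable ⟨a, ha⟩ ⟨b, hb⟩ := by
  constructor
  · rintro ⟨ha, h⟩
    refine ⟨ha, ?_⟩
    induction h with
    | refl => exact ⟨ha, .refl _⟩
    | tail _ h ih => exact ⟨h.2.2, ih.2.trans (SimpleGraph.Adj.reachable (by simpa using h.1))⟩
  · rintro ⟨ha, hb, h⟩
    refine ⟨ha, ?_⟩
    rw [SimpleGraph.reachable_iff_reflTransGen] at h
    exact h.lift (Subtype.val) (fun x y hxy => ⟨by simpa using hxy, x.2, y.2⟩)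

theorem reachIn_univ : ReachIn G univ a b ↔ G.Reachable a b := by
  rw [SimpleGraph.reachable_iff_reflTransGen]
  simp [ReachIn]

/-- `G` has no cycles inside `S`, expressed through connections avoiding an edge. -/
def AcyclicIn (G : SimpleGraph V) (S : Set V) : Prop :=
  ∀ a ∈ S, ∀ b ∈ S, G.Adj a b → ¬ ReachIn (G.deleteEdges {s(a, b)}) S a b

theorem isAcyclic_induce_iff : (G.induce S).IsAcyclic ↔ AcyclicIn G S := by
  rw [SimpleGraph.isAcyclic_iff_forall_adj_isBridge]
  have key : ∀ (a b : S), ((G.induce S).deleteEdges {s(a, b)}) =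
      (G.deleteEdges {s(a.1, b.1)}).induce S := by
    intro a b
    ext x y
    simp [SimpleGraph.deleteEdges_adj, Subtype.ext_iff]
  constructor
  · intro h a ha b hb hab hr
    have := h (v := ⟨a, ha⟩) (w := ⟨b, hb⟩) (by simpa using hab)
    rw [SimpleGraph.isBridge_iff, key] at this
    obtain ⟨_, _, hr⟩ := reachIn_iff_induce.1 hr
    exact this hr
  · intro h a b hab
    rw [SimpleGraph.isBridge_iff, key]
    intro hr
    exact h a a.2 b b.2 (by simpa using hab) (reachIn_iff_induce.2 ⟨a.2, b.2, hr⟩)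

theorem isAcyclic_iff_acyclicIn_univ : G.IsAcyclic ↔ AcyclicIn G univ := by
  rw [← isAcyclic_induce_iff]
  exact (SimpleGraph.induceUnivIso G).symm.isAcyclic_iff

theorem AcyclicIn.mono {H : SimpleGraph V}
    (hGH : ∀ x ∈ S, ∀ y ∈ S, G.Adj x y → H.Adj x y) (hST : S ⊆ T)
    (h : AcyclicIn H T) : AcyclicIn G S := fun a ha b hb hab hr =>
  h a (hST ha) b (hST hb) (hGH a ha b hb hab) (hr.mono (fun x hx y hy hxy => by
    rw [SimpleGraph.deleteEdges_adj] at hxy ⊢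
    exact ⟨hGH x hx y hy hxy.1, hxy.2⟩) hST)

theorem reachIn_congr {H : SimpleGraph V} (h : ∀ x ∈ S, ∀ y ∈ S, G.Adj x y ↔ H.Adj x y) :
    ReachIn G S a b ↔ ReachIn H S a b :=
  ⟨.mono (fun x hx y hy => (h x hx y hy).1) le_rfl, .mono (fun x hx y hy => (h x hx y hy).2) le_rfl⟩

theorem acyclicIn_congr {H : SimpleGraph V} (h : ∀ x ∈ S, ∀ y ∈ S, G.Adj x y ↔ H.Adj x y) :
    AcyclicIn G S ↔ AcyclicIn H S :=
  ⟨.mono (fun x hx y hy => (h x hx y hy).2) le_rfl, .mono (fun x hx y hy => (h x hx y hy).1) le_rfl⟩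

/-! ### Adding a vertex -/

/-- Cut the walk at its first and its last visit to `x`: `p` is the vertex before the former, `q`
the one after the latter. The clause for `b = x` keeps the induction along the walk going. -/
theorem reachIn_insert_aux {x : V} (hx : x ∉ S) (ha : a ∈ S) (h : ReachIn G (insert x S) a b) :
    (b ∈ S → ReachIn G S a b ∨ ∃ p ∈ S, ∃ q ∈ S, G.Adj x p ∧ G.Adj x q ∧
      ReachIn G S a p ∧ ReachIn G S q b) ∧
    (b = x → ∃ p ∈ S, G.Adj x p ∧ ReachIn G S a p) := by
  have h2 := h.2
  clear h
  induction h2 with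
  | refl => exact ⟨fun _ => .inl (.refl ha), fun h => (hx (h ▸ ha)).elim⟩
  | @tail b c _ h ih =>
    obtain ⟨hbc, hb, hc⟩ := h
    rcases hb with rfl | hb
    · refine ⟨fun hc => ?_, fun hc => (hbc.ne hc.symm).elim⟩
      obtain ⟨p, hp, hxp, hap⟩ := ih.2 rfl
      exact .inr ⟨p, hp, c, hc, hxp, hbc, hap, .refl hc⟩
    · refine ⟨fun hc => ?_, ?_⟩
      · have hbc' := ReachIn.of_adj hbc hb hc
        rcases ih.1 hb with h | ⟨p, hp, q, hq, hxp, hxq, h1, h2⟩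
        · exact .inl (h.trans hbc')
        · exact .inr ⟨p, hp, q, hq, hxp, hxq, h1, h2.trans hbc'⟩
      · rintro rfl
        rcases ih.1 hb with h | ⟨p, hp, q, hq, hxp, hxq, h1, h2⟩
        · exact ⟨b, hb, hbc.symm, h⟩
        · exact ⟨p, hp, hxp, h1⟩

theorem reachIn_insert {x : V} (hx : x ∉ S) (ha : a ∈ S) (hb : b ∈ S) :
    ReachIn G (insert x S) a b ↔ ReachIn G S a b ∨ ∃ p ∈ S, ∃ q ∈ S, G.Adj x p ∧ G.Adj x q ∧
      ReachIn G S a p ∧ ReachIn G S q b := by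
  refine ⟨fun h => (reachIn_insert_aux hx ha h).1 hb, ?_⟩
  have hm : ∀ {c d}, ReachIn G S c d → ReachIn G (insert x S) c d :=
    fun h => h.mono (fun _ _ _ _ h => h) (subset_insert x S)
  rintro (h | ⟨p, hp, q, hq, hxp, hxq, h1, h2⟩)
  · exact hm h
  · exact ((hm h1).trans (.of_adj hxp.symm (.inr hp) (.inl rfl))).trans
      ((ReachIn.of_adj hxq (.inl rfl) (.inr hq)).trans (hm h2))

theorem reachIn_insert_self {x : V} (hx : x ∉ S) (hb : b ∈ S) :
    ReachIn G (insert x S) x b ↔ ∃ p ∈ S, G.Adj x p ∧ ReachIn G S p b := by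
  constructor
  · intro h
    obtain ⟨p, hp, hxp, h⟩ := (reachIn_insert_aux hx hb h.symm).2 rfl
    exact ⟨p, hp, hxp, h.symm⟩
  · rintro ⟨p, hp, hxp, h⟩
    exact (ReachIn.of_adj hxp (.inl rfl) (.inr hp)).trans
      (h.mono (fun _ _ _ _ h => h) (subset_insert x S))

/-- A cycle through the new vertex enters and leaves it by two different neighbours, which are then
joined inside `S`. -/
theorem acyclicIn_insert {x : V} (hx : x ∉ S) :
    AcyclicIn G (insert x S) ↔ AcyclicIn G S ∧
      ∀ p ∈ S, ∀ q ∈ S, G.Adj x p → G.Adj x q → p ≠ q → ¬ ReachIn G S p q := by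
  have hdel : ∀ p, ∀ {c d}, ReachIn G S c d → ReachIn (G.deleteEdges {s(x, p)}) S c d := by
    intro p c d h
    refine h.mono (fun y hy z hz hyz => ?_) le_rfl
    rw [SimpleGraph.deleteEdges_adj]
    refine ⟨hyz, fun h => ?_⟩
    rcases Sym2.eq_iff.1 (mem_singleton_iff.1 h) with ⟨rfl, -⟩ | ⟨-, rfl⟩
    · exact hx hy
    · exact hx hz
  have hle : ∀ (s : Set (Sym2 V)) {c d : V}, ReachIn (G.deleteEdges s) S c d → ReachIn G S c d :=
    fun s c d h => h.mono (fun _ _ _ _ h => (SimpleGraph.deleteEdges_adj.1 h).1) le_rfl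
  have hxp : ∀ p ∈ S, G.Adj x p → (∀ q ∈ S, G.Adj x p → G.Adj x q → p ≠ q → ¬ ReachIn G S p q) →
      ¬ ReachIn (G.deleteEdges {s(x, p)}) (insert x S) x p := by
    intro p hp hxp h h'
    obtain ⟨q, hq, hxq, h'⟩ := (reachIn_insert_self hx hp).1 h'
    rw [SimpleGraph.deleteEdges_adj] at hxq
    refine h q hq hxp hxq.1 ?_ (hle _ h').symm
    rintro rfl
    exact hxq.2 rfl
  constructor
  · refine fun h => ⟨h.mono (fun _ _ _ _ h => h) (subset_insert x S), ?_⟩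
    intro p hp q hq hxp hxq hpq hr
    refine h x (.inl rfl) p (.inr hp) hxp ((reachIn_insert_self hx hp).2 ⟨q, hq, ?_, (hdel p hr).symm⟩)
    rw [SimpleGraph.deleteEdges_adj]
    refine ⟨hxq, fun h => ?_⟩
    rcases Sym2.eq_iff.1 (mem_singleton_iff.1 h) with ⟨-, rfl⟩ | ⟨rfl, -⟩
    · exact hpq rfl
    · exact hx hp
  · rintro ⟨hS, hN⟩ a ha b hb hab hr
    rcases ha with rfl | ha
    · rcases hb with rfl | hb
      · exact hab.ne rfl
      · exact hxp b hb hab (fun q hq => hN b hb q hq) hr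
    · rcases hb with rfl | hb
      · rw [Sym2.eq_swap] at hr
        exact hxp a ha hab.symm (fun q hq => hN a ha q hq) hr.symm
      · rcases (reachIn_insert hx ha hb).1 hr with h | ⟨p, hp, q, hq, hxp, hxq, h1, h2⟩
        · exact hS a ha b hb hab h
        · rw [SimpleGraph.deleteEdges_adj] at hxp hxq
          by_cases hpq : p = q
          · subst hpq
            exact hS a ha b hb hab (h1.trans h2)
          · exact hN p hp q hq hxp.1 hxq.1 hpq
              (((hle _ h1).symm.trans (.of_adj hab ha hb)).trans (hle _ h2).symm)

/-! ### Increasing unions -/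

theorem reachIn_iUnion {S : ℕ → Set V} (hS : Monotone S) :
    ReachIn G (⋃ k, S k) a b ↔ ∃ k, ReachIn G (S k) a b := by
  constructor
  · rintro ⟨ha, h⟩
    induction h with
    | refl =>
      obtain ⟨k, hk⟩ := mem_iUnion.1 ha
      exact ⟨k, .refl hk⟩
    | tail _ h ih =>
      obtain ⟨k, hk⟩ := ih
      obtain ⟨h, h1, h2⟩ := h
      obtain ⟨k1, hk1⟩ := mem_iUnion.1 h1
      obtain ⟨k2, hk2⟩ := mem_iUnion.1 h2
      refine ⟨max k (max k1 k2), (hk.mono (fun _ _ _ _ h => h) (hS (le_max_left _ _))).trans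
        (.of_adj h (hS ?_ hk1) (hS ?_ hk2))⟩ <;> simp
  · rintro ⟨k, h⟩
    exact h.mono (fun _ _ _ _ h => h) (subset_iUnion S k)

theorem acyclicIn_iUnion {S : ℕ → Set V} (hS : Monotone S) :
    AcyclicIn G (⋃ k, S k) ↔ ∀ k, AcyclicIn G (S k) := by
  refine ⟨fun h k => h.mono (fun _ _ _ _ h => h) (subset_iUnion S k), fun h a _ b _ hab hr => ?_⟩
  obtain ⟨k, hk⟩ := (reachIn_iUnion hS).1 hr
  exact h k a hk.1 b hk.right_mem hab hk

end Reachability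


/-! ### Forests and their types -/

/-- Each edge is recorded in the configuration at its larger end point. -/
theorem graph_adj_of_lt {t : Config} {a b : ℤ} (h : a < b) :
    (graph t).Adj a b ↔ (a = b - 3 ∧ (t b).1 = true) ∨ (a = b - 1 ∧ (t b).2 = true) := by
  simp only [graph, SimpleGraph.fromEdgeSet_adj, edges, Set.mem_ofPred_eq, Sym2.eq_iff]
  constructor
  · rintro ⟨⟨j, ⟨h1, ⟨rfl, rfl⟩ | ⟨rfl, rfl⟩⟩ | ⟨h1, ⟨rfl, rfl⟩ | ⟨rfl, rfl⟩⟩⟩, -⟩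
    · exact .inl ⟨rfl, h1⟩
    · omega
    · exact .inr ⟨rfl, h1⟩
    · omega
  · rintro (⟨rfl, h1⟩ | ⟨rfl, h1⟩)
    · exact ⟨⟨b, .inl ⟨h1, .inl ⟨rfl, rfl⟩⟩⟩, by omega⟩
    · exact ⟨⟨b, .inr ⟨h1, .inl ⟨rfl, rfl⟩⟩⟩, by omega⟩

/-- The entry at `m` itself is irrelevant: an edge recorded there starts below `m`. -/
theorem graph_adj_congr {t t' : Config} {m n : ℤ} (h : ∀ k, m < k → k ≤ n → t k = t' k)
    (x : ℤ) (hx : x ∈ Icc m n) (y : ℤ) (hy : y ∈ Icc m n) :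
    (graph t).Adj x y ↔ (graph t').Adj x y := by
  obtain ⟨hx1, hx2⟩ := hx
  obtain ⟨hy1, hy2⟩ := hy
  rcases lt_trichotomy x y with hlt | rfl | hlt
  · rw [graph_adj_of_lt hlt, graph_adj_of_lt hlt, h y (by omega) hy2]
  · simp
  · rw [SimpleGraph.adj_comm, graph_adj_of_lt hlt, SimpleGraph.adj_comm, graph_adj_of_lt hlt,
      h x (by omega) hx2]

/-- How three points are distributed over components, in terms of the three relations
`first ~ second`, `second ~ third`, `first ~ third`. -/
def TriplePattern (a b c : Prop) : Fin 5 → Prop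
  | 0 => a ∧ b
  | 1 => ¬ a ∧ b
  | 2 => a ∧ ¬ b
  | 3 => ¬ a ∧ c
  | 4 => ¬ a ∧ ¬ b ∧ ¬ c

/-- Only the patterns with indices `1` and `3` could overlap, namely when `b` and `c` hold without
`a`; this instance of transitivity rules that out. -/
theorem TriplePattern.eq {a b c : Prop} (h : b → c → a) {i j : Fin 5}
    (hi : TriplePattern a b c i) (hj : TriplePattern a b c j) : i = j := by
  fin_cases i <;> fin_cases j <;> simp only [TriplePattern] at hi hj <;> first | rfl | tauto

theorem exists_triplePattern (a b c : Prop) : ∃ i, TriplePattern a b c i := by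
  by_cases ha : a <;> by_cases hb : b <;> by_cases hc : c
  · exact ⟨0, ha, hb⟩
  · exact ⟨0, ha, hb⟩
  · exact ⟨2, ha, hb⟩
  · exact ⟨2, ha, hb⟩
  · exact ⟨1, ha, hb⟩
  · exact ⟨1, ha, hb⟩
  · exact ⟨3, ha, hc⟩
  · exact ⟨4, ha, hb, hc⟩

/-- The restriction of `t` to `S` is a forest, each component of which contains one of the points
`n, n - 1, n - 2`, of type `i`. -/
def ForestOn (t : Config) (S : Set ℤ) (n : ℤ) (i : Fin 5) : Prop :=
  AcyclicIn (graph t) S ∧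
    (∀ v ∈ S, ReachIn (graph t) S v n ∨ ReachIn (graph t) S v (n - 1) ∨
      ReachIn (graph t) S v (n - 2)) ∧
    TriplePattern (ReachIn (graph t) S n (n - 1)) (ReachIn (graph t) S (n - 1) (n - 2))
      (ReachIn (graph t) S n (n - 2)) i

theorem ForestOn.eq {t : Config} {S : Set ℤ} {n : ℤ} {i j : Fin 5} (hi : ForestOn t S n i)
    (hj : ForestOn t S n j) : i = j :=
  TriplePattern.eq (fun h1 h2 => h2.trans h1.symm) hi.2.2 hj.2.2

theorem sameComponent_iff {t : Config} {n a b : ℤ} :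
    SameComponent t n a b ↔ ReachIn (graph t) (Iic n) a b := reachIn_iff_induce.symm

theorem mem_gamma_iff {t : Config} {n : ℤ} {i : Fin 5} :
    t ∈ Gamma n i ↔ ForestOn t (Iic n) n i := by
  have : ConnectionPattern t n i ↔ TriplePattern (ReachIn (graph t) (Iic n) n (n - 1))
      (ReachIn (graph t) (Iic n) (n - 1) (n - 2)) (ReachIn (graph t) (Iic n) n (n - 2)) i := by
    fin_cases i <;> simp [ConnectionPattern, TriplePattern, sameComponent_iff]
  simp only [Gamma, Set.mem_ofPred_eq, ForestOn, leftGraph, isAcyclic_induce_iff, this,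
    sameComponent_iff, mem_Iic]

theorem forestOn_congr {t t' : Config} {m n : ℤ} (h : ∀ k, m < k → k ≤ n → t k = t' k) (l : ℤ)
    (i : Fin 5) : ForestOn t (Icc m n) l i ↔ ForestOn t' (Icc m n) l i := by
  have h1 := graph_adj_congr h
  have h2 := fun a b => reachIn_congr (a := a) (b := b) h1
  simp only [ForestOn, acyclicIn_congr h1, h2]

/-- The type of the forest after adding a vertex to a forest of a given type, with the given
edges (`h` first, `z` second) to the older vertices; `none` if this is not a legal forest. -/
def step : Fin 5 → Bool × Bool → Option (Fin 5)
  | 0, (false, true) => some 0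
  | 0, (true, false) => some 0
  | 0, (false, false) => some 1
  | 1, (true, true) => some 0
  | 1, (false, true) => some 2
  | 1, (true, false) => some 3
  | 1, (false, false) => some 4
  | 2, (true, true) => some 0
  | 2, (true, false) => some 1
  | 3, (false, true) => some 2
  | 3, (true, false) => some 2
  | 3, (false, false) => some 4
  | 4, (true, true) => some 2
  | 4, (true, false) => some 4
  | _, _ => none

/-- The correctness of the table `step`. The three conditions on the right say that the new vertex
closes no cycle, that the point leaving the window of three keeps its component attached to the new
window, and how the new window is distributed over the components. -/
theorem exists_step_iff (p : Bool × Bool) {a b c : Prop} (h1 : a → b → c) (h2 : a → c → b)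
    (h3 : b → c → a) (j : Fin 5) :
    (∃ i, TriplePattern a b c i ∧ step i p = some j) ↔
      (p.1 = true → p.2 = true → ¬ c) ∧ (p.1 = true ∨ b ∨ c) ∧
        TriplePattern (p.2 = true ∨ (p.1 = true ∧ c))
          (a ∨ (p.1 = true ∧ p.2 = true ∧ (b ∨ c ∧ a)))
          ((p.2 = true ∧ a) ∨ (p.1 = true ∧ b)) j := by
  obtain ⟨H, Z⟩ := p
  obtain ⟨i, hi⟩ := exists_triplePattern a b c
  have : (∃ i, TriplePattern a b c i ∧ step i (H, Z) = some j) ↔ step i (H, Z) = some j :=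
    ⟨fun ⟨i', h, h'⟩ => TriplePattern.eq h3 hi h ▸ h', fun h => ⟨i, hi, h⟩⟩
  rw [this]
  clear this
  cases H <;> cases Z <;> fin_cases i <;> fin_cases j <;> simp [step, TriplePattern] at hi ⊢ <;> tauto

/-- The automaton property. The only possible neighbours of `n + 1` in `S` are `n` and `n - 2`, so
every new connection is a Boolean combination of old connections within the window and the two new
edges. The vertex `n - 2` drops out of the window; its component survives only if it contains `n -
1` or `n`, or receives the edge to `n + 1`. -/
theorem forestOn_insert {t : Config} {S : Set ℤ} {n : ℤ} (hS : S ⊆ Iic n) (h0 : n ∈ S)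
    (h1 : n - 1 ∈ S) (h2 : n - 2 ∈ S) (j : Fin 5) :
    ForestOn t (insert (n + 1) S) (n + 1) j ↔
      ∃ i, ForestOn t S n i ∧ step i (t (n + 1)) = some j := by
  have hx : n + 1 ∉ S := fun h => by have := hS h; simp at this
  set r := ReachIn (graph t) S with hr
  set r' := ReachIn (graph t) (insert (n + 1) S) with hr'
  set H : Prop := (t (n + 1)).1 = true with hH
  set Z : Prop := (t (n + 1)).2 = true with hZ
  have hN : ∀ p ∈ S, ((graph t).Adj (n + 1) p ↔ (p = n - 2 ∧ H) ∨ (p = n ∧ Z)) := by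
    intro p hp
    rw [SimpleGraph.adj_comm, graph_adj_of_lt (by have := hS hp; simp at this; omega),
      show n + 1 - 3 = n - 2 by ring, show n + 1 - 1 = n by ring]
  have hsymm : ∀ {x y}, r x y → r y x := fun h => h.symm
  have htrans : ∀ {x y z}, r x y → r y z → r x z := fun h h' => h.trans h'
  have hred : ∀ x ∈ S, ∀ y ∈ S, (r' x y ↔ r x y ∨ (H ∧ Z ∧ ((r x n ∧ r (n - 2) y) ∨
      (r x (n - 2) ∧ r n y)))) := by
    intro x hxS y hyS
    rw [hr', reachIn_insert hx hxS hyS]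
    constructor
    · rintro (h | ⟨p, hp, q, hq, hxp, hxq, h3, h4⟩)
      · exact .inl h
      · rw [hN p hp] at hxp
        rw [hN q hq] at hxq
        rcases hxp with ⟨rfl, hH⟩ | ⟨rfl, hZ⟩ <;> rcases hxq with ⟨rfl, hH'⟩ | ⟨rfl, hZ'⟩
        · exact .inl (h3.trans h4)
        · exact .inr ⟨hH, hZ', .inr ⟨h3, h4⟩⟩
        · exact .inr ⟨hH', hZ, .inl ⟨h3, h4⟩⟩
        · exact .inl (h3.trans h4)
    · rintro (h | ⟨hH, hZ, ⟨h3, h4⟩ | ⟨h3, h4⟩⟩)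
      · exact .inl h
      · exact .inr ⟨n, h0, n - 2, h2, (hN _ h0).2 (.inr ⟨rfl, hZ⟩), (hN _ h2).2 (.inl ⟨rfl, hH⟩),
          h3, h4⟩
      · exact .inr ⟨n - 2, h2, n, h0, (hN _ h2).2 (.inl ⟨rfl, hH⟩), (hN _ h0).2 (.inr ⟨rfl, hZ⟩),
          h3, h4⟩
  have hself : ∀ y ∈ S, (r' (n + 1) y ↔ (Z ∧ r n y) ∨ (H ∧ r (n - 2) y)) := by
    intro y hyS
    rw [hr', reachIn_insert_self hx hyS]
    constructor
    · rintro ⟨p, hp, hxp, h⟩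
      rw [hN p hp] at hxp
      rcases hxp with ⟨rfl, hH⟩ | ⟨rfl, hZ⟩
      · exact .inr ⟨hH, h⟩
      · exact .inl ⟨hZ, h⟩
    · rintro (⟨hZ, h⟩ | ⟨hH, h⟩)
      · exact ⟨n, h0, (hN _ h0).2 (.inr ⟨rfl, hZ⟩), h⟩
      · exact ⟨n - 2, h2, (hN _ h2).2 (.inl ⟨rfl, hH⟩), h⟩
  have hself' : ∀ y, r' y (n + 1) ↔ r' (n + 1) y := fun y => reachIn_comm
  have hac : AcyclicIn (graph t) (insert (n + 1) S) ↔
      AcyclicIn (graph t) S ∧ (H → Z → ¬ r n (n - 2)) := by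
    rw [acyclicIn_insert hx]
    refine and_congr_right fun _ => ⟨fun h hH hZ => h n h0 (n - 2) h2
      ((hN _ h0).2 (.inr ⟨rfl, hZ⟩)) ((hN _ h2).2 (.inl ⟨rfl, hH⟩)) (by omega), ?_⟩
    intro h p hp q hq hxp hxq hpq hpr
    rw [hN p hp] at hxp
    rw [hN q hq] at hxq
    rcases hxp with ⟨rfl, hH⟩ | ⟨rfl, hZ⟩ <;> rcases hxq with ⟨rfl, hH'⟩ | ⟨rfl, hZ'⟩
    · exact hpq rfl
    · exact h hH hZ' (hsymm hpr)
    · exact h hH' hZ hpr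
    · exact hpq rfl
  have hrefl : ∀ x ∈ S, r x x := fun x hx => .refl hx
  have hcov : (∀ v ∈ insert (n + 1) S, r' v (n + 1) ∨ r' v (n + 1 - 1) ∨ r' v (n + 1 - 2)) ↔
      (∀ v ∈ S, r v n ∨ r v (n - 1) ∨ r v (n - 2)) ∧ (H ∨ r (n - 1) (n - 2) ∨ r n (n - 2)) := by
    rw [show n + 1 - 1 = n by ring, show n + 1 - 2 = n - 1 by ring]
    constructor
    · intro h
      constructor
      · intro v hv
        have := h v (.inr hv)
        rw [hself', hself v hv, hred v hv n h0, hred v hv _ h1] at this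
        rcases this with (⟨_, h⟩ | ⟨_, h⟩) | (h | ⟨_, _, ⟨h, _⟩ | ⟨h, _⟩⟩) |
          (h | ⟨_, _, ⟨h, _⟩ | ⟨h, _⟩⟩)
        · exact .inl (hsymm h)
        · exact .inr (.inr (hsymm h))
        · exact .inl h
        · exact .inl h
        · exact .inr (.inr h)
        · exact .inr (.inl h)
        · exact .inl h
        · exact .inr (.inr h)
      · have := h (n - 2) (.inr h2)
        rw [hself', hself _ h2, hred _ h2 n h0, hred _ h2 _ h1] at this
        rcases this with (⟨_, h⟩ | ⟨hH, h⟩) | (h | ⟨hH, _⟩) | (h | ⟨hH, _⟩)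
        · exact .inr (.inr h)
        · exact .inl hH
        · exact .inr (.inr (hsymm h))
        · exact .inl hH
        · exact .inr (.inl (hsymm h))
        · exact .inl hH
    · rintro ⟨h, h'⟩ v (rfl | hv)
      · exact .inl (.refl (.inl rfl))
      · rw [hself', hself v hv, hred v hv n h0, hred v hv _ h1]
        rcases h v hv with h | h | h
        · exact .inr (.inl (.inl h))
        · exact .inr (.inr (.inl h))
        · rcases h' with h' | h' | h'
          · exact .inl (.inr ⟨h', hsymm h⟩)
          · exact .inr (.inr (.inl (htrans h (hsymm h'))))
          · exact .inr (.inl (.inl (htrans h (hsymm h'))))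
  have hpat : ∀ j, TriplePattern (r' (n + 1) (n + 1 - 1)) (r' (n + 1 - 1) (n + 1 - 2))
      (r' (n + 1) (n + 1 - 2)) j ↔ TriplePattern (Z ∨ (H ∧ r n (n - 2)))
          (r n (n - 1) ∨ (H ∧ Z ∧ (r (n - 1) (n - 2) ∨ r n (n - 2) ∧ r n (n - 1))))
          ((Z ∧ r n (n - 1)) ∨ (H ∧ r (n - 1) (n - 2))) j := by
    intro j
    rw [show n + 1 - 1 = n by ring, show n + 1 - 2 = n - 1 by ring, hself n h0, hself _ h1,
      hred n h0 _ h1]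
    have e1 : r (n - 2) n ↔ r n (n - 2) := reachIn_comm
    have e2 : r (n - 2) (n - 1) ↔ r (n - 1) (n - 2) := reachIn_comm
    have e3 : r n n ↔ True := iff_true_intro (hrefl n h0)
    rw [e1, e2, e3]
    simp only [and_true, true_and]
  have hstep := exists_step_iff (t (n + 1)) (a := r n (n - 1)) (b := r (n - 1) (n - 2))
    (c := r n (n - 2)) (fun h h' => htrans h h') (fun h h' => htrans (hsymm h) h')
    (fun h h' => htrans h' (hsymm h)) j
  unfold ForestOn
  rw [hac, hcov, hpat]
  constructor
  · rintro ⟨⟨ha, hb⟩, ⟨hc, hd⟩, he⟩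
    obtain ⟨i, hi, hi'⟩ := hstep.2 ⟨hb, hd, he⟩
    exact ⟨i, ⟨ha, hc, hi⟩, hi'⟩
  · rintro ⟨i, ⟨ha, hc, hi⟩, hi'⟩
    obtain ⟨hb, hd, he⟩ := hstep.1 ⟨i, hi, hi'⟩
    exact ⟨⟨ha, hb⟩, ⟨hc, hd⟩, he⟩

theorem forestOn_Icc_succ {t : Config} {m n : ℤ} (h : m + 2 ≤ n) (j : Fin 5) :
    ForestOn t (Icc m (n + 1)) (n + 1) j ↔
      ∃ i, ForestOn t (Icc m n) n i ∧ step i (t (n + 1)) = some j := by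
  rw [← forestOn_insert (S := Icc m n) (fun x hx => hx.2) ⟨by omega, le_rfl⟩ ⟨by omega, by omega⟩
    ⟨by omega, by omega⟩]
  have : Icc m (n + 1) = insert (n + 1) (Icc m n) := by
    ext x; simp only [mem_Icc, mem_insert_iff]; omega
  rw [this]

theorem forestOn_Iic_succ {t : Config} {n : ℤ} (j : Fin 5) :
    ForestOn t (Iic (n + 1)) (n + 1) j ↔
      ∃ i, ForestOn t (Iic n) n i ∧ step i (t (n + 1)) = some j := by
  rw [← forestOn_insert (fun x hx => hx) (by simp) (by simp) (by simp)]
  have : Iic (n + 1) = insert (n + 1) (Iic n) := by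
    ext x; simp only [mem_Iic, mem_insert_iff]; omega
  rw [this]

/-- The type of the forest on three consecutive vertices, depending on whether the first and the
last two of them are joined by an edge. -/
def initialType : Bool → Bool → Fin 5
  | true, true => 0
  | true, false => 1
  | false, true => 2
  | false, false => 4

/-- The start of the automaton: an edge of length three does not fit into three consecutive
vertices, so only the two short edges matter. -/
theorem forestOn_three {t : Config} {m : ℤ} (i : Fin 5) :
    ForestOn t (Icc m (m + 2)) (m + 2) i ↔ i = initialType (t (m + 1)).2 (t (m + 2)).2 := by
  have hS : Icc m (m + 2) = insert (m + 2) (insert (m + 1) {m}) := by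
    ext x; simp only [mem_Icc, mem_insert_iff, mem_singleton_iff]; omega
  have hx1 : m + 1 ∉ ({m} : Set ℤ) := by simp
  have hx2 : m + 2 ∉ (insert (m + 1) {m} : Set ℤ) := by simp
  have hadj1 : (graph t).Adj (m + 1) m ↔ (t (m + 1)).2 = true := by
    rw [SimpleGraph.adj_comm, graph_adj_of_lt (by omega)]; simp; omega
  have hadj2 : (graph t).Adj (m + 2) m ↔ False := by
    rw [SimpleGraph.adj_comm, graph_adj_of_lt (by omega)]; simp; omega
  have hadj3 : (graph t).Adj (m + 2) (m + 1) ↔ (t (m + 2)).2 = true := by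
    rw [SimpleGraph.adj_comm, graph_adj_of_lt (by omega)]
    simp only [show m + 1 = m + 2 - 1 by ring, true_and, or_iff_right_iff_imp]; omega
  have hr0 : ReachIn (graph t) {m} m m := .refl rfl
  have hr1 : ReachIn (graph t) (insert (m + 1) {m}) (m + 1) m ↔ (t (m + 1)).2 = true := by
    rw [reachIn_insert_self hx1 rfl]; simp [hadj1, hr0]
  have hr11 : ReachIn (graph t) (insert (m + 1) {m}) (m + 1) (m + 1) := .refl (.inl rfl)
  have hr2 : ReachIn (graph t) (insert (m + 2) (insert (m + 1) {m})) (m + 2) (m + 1) ↔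
      (t (m + 2)).2 = true := by
    rw [reachIn_insert_self hx2 (.inl rfl)]; simp [hadj2, hadj3, hr11]
  have hr3 : ReachIn (graph t) (insert (m + 2) (insert (m + 1) {m})) (m + 2) m ↔
      (t (m + 2)).2 = true ∧ (t (m + 1)).2 = true := by
    rw [reachIn_insert_self hx2 (.inr rfl)]; simp [hadj2, hadj3, hr1]
  have hr4 : ReachIn (graph t) (insert (m + 2) (insert (m + 1) {m})) (m + 1) m ↔
      (t (m + 1)).2 = true := by
    rw [reachIn_insert hx2 (.inl rfl) (.inr rfl)]
    simp [hadj2, hadj3, hr1, hr11]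
  have hac : AcyclicIn (graph t) (insert (m + 2) (insert (m + 1) {m})) := by
    rw [acyclicIn_insert hx2, acyclicIn_insert hx1]
    refine ⟨⟨?_, ?_⟩, ?_⟩
    · rintro a rfl b rfl h; exact (h.ne rfl).elim
    · rintro p rfl q rfl _ _ h; exact (h rfl).elim
    · rintro p (rfl | rfl) q (rfl | rfl) h h'
      · exact fun h => (h rfl).elim
      · exact (hadj2.1 h').elim
      · exact (hadj2.1 h).elim
      · exact fun h => (h rfl).elim
  unfold ForestOn
  rw [hS, show m + 2 - 1 = m + 1 by ring, show m + 2 - 2 = m by ring, hr2, hr3, hr4]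
  have hcov : ∀ v ∈ (insert (m + 2) (insert (m + 1) {m}) : Set ℤ),
      ReachIn (graph t) (insert (m + 2) (insert (m + 1) {m})) v (m + 2) ∨
      ReachIn (graph t) (insert (m + 2) (insert (m + 1) {m})) v (m + 1) ∨
      ReachIn (graph t) (insert (m + 2) (insert (m + 1) {m})) v m := by
    rintro v (rfl | rfl | rfl)
    · exact .inl (.refl (.inl rfl))
    · exact .inr (.inl (.refl (.inr (.inl rfl))))
    · exact .inr (.inr (.refl (.inr (.inr rfl))))
  simp only [hac, true_and]
  rw [and_iff_right hcov]
  generalize (t (m + 1)).2 = x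
  generalize (t (m + 2)).2 = y
  cases x <;> cases y <;> fin_cases i <;> simp [TriplePattern, initialType]

theorem iUnion_Icc_sub (n : ℤ) : ⋃ k : ℕ, Icc (n - k) n = Iic n := by
  ext x
  simp only [mem_iUnion, mem_Icc, mem_Iic]
  exact ⟨fun ⟨_, h⟩ => h.2, fun h => ⟨(n - x).toNat, by omega, h⟩⟩

theorem monotone_Icc_sub (n : ℤ) : Monotone fun k : ℕ => Icc (n - k) n :=
  fun k l h => Icc_subset_Icc (by omega) le_rfl

theorem reachIn_Iic {G : SimpleGraph ℤ} {n a b : ℤ} :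
    ReachIn G (Iic n) a b ↔ ∃ k : ℕ, ReachIn G (Icc (n - k) n) a b := by
  rw [← iUnion_Icc_sub, reachIn_iUnion (monotone_Icc_sub n)]

theorem acyclicIn_Iic {G : SimpleGraph ℤ} {n : ℤ} :
    AcyclicIn G (Iic n) ↔ ∀ k : ℕ, AcyclicIn G (Icc (n - k) n) := by
  rw [← iUnion_Icc_sub, acyclicIn_iUnion (monotone_Icc_sub n)]

/-- A walk is finite, so each of the three connections within the window has the same truth value in
`Icc m n` as in `Iic n` once `m` is small enough. The type in `Icc m n` is therefore eventually
constant, and arbitrarily small `m` suffice to identify it. -/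
theorem forestOn_Iic_of_frequently {t : Config} {n : ℤ} {i : Fin 5}
    (h : ∀ m₀, ∃ m ≤ m₀, ForestOn t (Icc m n) n i) : ForestOn t (Iic n) n i := by
  have hsub : ∀ m, Icc m n ⊆ Iic n := fun m x hx => hx.2
  have hmono : ∀ {m a b}, ReachIn (graph t) (Icc m n) a b → ReachIn (graph t) (Iic n) a b :=
    fun h => h.mono (fun _ _ _ _ h => h) (hsub _)
  refine ⟨acyclicIn_Iic.2 fun k => ?_, fun v hv => ?_, ?_⟩
  · obtain ⟨m, hm, hf⟩ := h (n - k)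
    exact hf.1.mono (fun _ _ _ _ h => h) (Icc_subset_Icc hm le_rfl)
  · obtain ⟨m, hm, hf⟩ := h v
    exact (hf.2.1 v ⟨hm, hv⟩).imp hmono (Or.imp hmono hmono)
  · have key : ∀ a b, ∃ m₀, ∀ m ≤ m₀, (ReachIn (graph t) (Iic n) a b ↔
        ReachIn (graph t) (Icc m n) a b) := by
      intro a b
      by_cases hab : ReachIn (graph t) (Iic n) a b
      · obtain ⟨k, hk⟩ := reachIn_Iic.1 hab
        exact ⟨n - k, fun m hm => iff_of_true hab (hk.mono (fun _ _ _ _ h => h)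
          (Icc_subset_Icc hm le_rfl))⟩
      · exact ⟨n, fun m _ => iff_of_false hab fun h => hab (hmono h)⟩
    obtain ⟨m1, h1⟩ := key n (n - 1)
    obtain ⟨m2, h2⟩ := key (n - 1) (n - 2)
    obtain ⟨m3, h3⟩ := key n (n - 2)
    obtain ⟨m, hm, hf⟩ := h (min m1 (min m2 m3))
    rw [h1 m (by omega), h2 m (by omega), h3 m (by omega)]
    exact hf.2.2

/-! ### Spanning trees -/

/-- For the covering condition, follow the walk in the tree from `v` to `n + 1`. Edges have length
at most three, so the vertex from which it first leaves `Iic n` is `n`, `n - 1` or `n - 2`. -/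
theorem exists_forestOn_of_isTree {t : Config} (ht : t ∈ spanningTrees) (n : ℤ) :
    ∃ i, ForestOn t (Iic n) n i := by
  have ht : (graph t).IsTree := ht
  obtain ⟨i, hi⟩ := exists_triplePattern (ReachIn (graph t) (Iic n) n (n - 1))
    (ReachIn (graph t) (Iic n) (n - 1) (n - 2)) (ReachIn (graph t) (Iic n) n (n - 2))
  refine ⟨i, (isAcyclic_iff_acyclicIn_univ.1 ht.isAcyclic).mono (fun _ _ _ _ h => h)
    (subset_univ _), fun v hv => ?_, hi⟩
  have hr := (SimpleGraph.reachable_iff_reflTransGen _ _).1 (ht.connected.preconnected v (n + 1))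
  suffices ∀ b, Relation.ReflTransGen (graph t).Adj v b →
      (ReachIn (graph t) (Iic n) v n ∨ ReachIn (graph t) (Iic n) v (n - 1) ∨
        ReachIn (graph t) (Iic n) v (n - 2)) ∨ ReachIn (graph t) (Iic n) v b by
    rcases this _ hr with h | h
    · exact h
    · have := h.right_mem
      simp at this
  intro b hb
  induction hb with
  | refl => exact .inr (.refl hv)
  | @tail b c _ hbc ih =>
    rcases ih with h | h
    · exact .inl h
    · have hb : b ≤ n := h.right_mem
      by_cases hc : c ≤ n
      · exact .inr (h.trans (.of_adj hbc hb hc))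
      · have hlt : b < c := by omega
        rw [graph_adj_of_lt hlt] at hbc
        have : b = n ∨ b = n - 1 ∨ b = n - 2 := by omega
        left
        rcases this with rfl | rfl | rfl
        · exact .inl h
        · exact .inr (.inl h)
        · exact .inr (.inr h)

theorem existsUnique_gamma {t : Config} (ht : t ∈ spanningTrees) (n : ℤ) :
    ∃! i : Fin 5, t ∈ Gamma n i := by
  obtain ⟨i, hi⟩ := exists_forestOn_of_isTree ht n
  exact ⟨i, mem_gamma_iff.2 hi, fun j hj => (mem_gamma_iff.1 hj).eq hi⟩

theorem forestType_eq {t : Config} {n : ℤ} {i : Fin 5} (h : ForestOn t (Iic n) n i) :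
    forestType t n = i := by
  have hex : ∃ i, t ∈ Gamma n i := ⟨i, mem_gamma_iff.2 h⟩
  rw [forestType, dif_pos hex]
  exact (mem_gamma_iff.1 hex.choose_spec).eq h

theorem symbol_injective : Function.Injective symbol := by decide

theorem exists_symbol_of_step : ∀ (i : Fin 5) (p : Bool × Bool) (j : Fin 5),
    step i p = some j → ∃ k, symbol k = (p.1, p.2, j) := by decide

theorem Y_eq {t : Config} {n : ℤ} {k : Fin 11} (h : symbol k = code n t) : Y n t = k := by
  rw [Y, ← h, Function.leftInverse_invFun symbol_injective]

theorem symbol_Y {t : Config} (ht : t ∈ spanningTrees) (n : ℤ) : symbol (Y n t) = code n t := by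
  obtain ⟨j, hj⟩ := exists_forestOn_of_isTree ht (n - 1 + 1)
  obtain ⟨i, -, hs⟩ := (forestOn_Iic_succ j).1 hj
  rw [sub_add_cancel] at hs hj
  obtain ⟨k, hk⟩ := exists_symbol_of_step _ _ _ hs
  have : symbol k = code n t := by rw [hk, code, forestType_eq hj]
  rw [Y_eq this, this]

/-- The spanning trees of a finite piece are the supported configurations of type 1. -/
theorem mem_finiteSpanningTrees_iff {t : Config} {m n : ℤ} (h : m + 2 ≤ n) :
    t ∈ finiteSpanningTrees m n ↔
      (∀ e ∈ edges t, ∀ v ∈ e, v ∈ Icc m n) ∧ ForestOn t (Icc m n) n 0 := by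
  simp only [finiteSpanningTrees, Set.mem_ofPred_eq]
  refine and_congr_right fun _ => ?_
  have h0 : n ∈ Icc m n := ⟨by omega, by omega⟩
  have h1 : n - 1 ∈ Icc m n := ⟨by omega, by omega⟩
  have h2 : n - 2 ∈ Icc m n := ⟨by omega, by omega⟩
  constructor
  · intro hT
    have hr : ∀ a ∈ Icc m n, ∀ b ∈ Icc m n, ReachIn (graph t) (Icc m n) a b := fun a ha b hb =>
      reachIn_iff_induce.2 ⟨ha, hb, hT.connected.preconnected _ _⟩
    exact ⟨isAcyclic_induce_iff.1 hT.isAcyclic, fun v hv => .inl (hr v hv n h0),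
      hr _ h0 _ h1, hr _ h1 _ h2⟩
  · rintro ⟨ha, hc, h3, h4⟩
    have hr : ∀ v ∈ Icc m n, ReachIn (graph t) (Icc m n) v n := by
      intro v hv
      rcases hc v hv with h | h | h
      · exact h
      · exact h.trans h3.symm
      · exact (h.trans h4.symm).trans h3.symm
    have : Nonempty (Icc m n) := ⟨⟨n, h0⟩⟩
    refine ⟨⟨fun a b => ?_⟩, isAcyclic_induce_iff.2 ha⟩
    obtain ⟨_, _, h⟩ := reachIn_iff_induce.1 ((hr a a.2).trans (hr b b.2).symm)
    exact h

/-! ### Measurability -/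

theorem measurableSet_of_dependsOn {ι F : Type*} [MeasurableSpace F] [Countable F]
    [MeasurableSingletonClass F] {A : Set (ι → F)} (I : Finset ι)
    (h : ∀ t t' : ι → F, (∀ k ∈ I, t k = t' k) → t ∈ A → t' ∈ A) : MeasurableSet A := by
  have : A = I.restrict ⁻¹' (I.restrict '' A) := by
    refine subset_antisymm (subset_preimage_image _ _) ?_
    rintro t ⟨t', ht', hr⟩
    exact h t' t (fun k hk => congrFun hr ⟨k, hk⟩) ht'
  rw [this]
  exact Finset.measurable_restrict I (Set.to_countable _).measurableSet

theorem measurableSet_reachIn (n a b : ℤ) :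
    MeasurableSet {t : Config | ReachIn (graph t) (Iic n) a b} := by
  simp only [reachIn_Iic, ofPred_exists]
  refine MeasurableSet.iUnion fun k => measurableSet_of_dependsOn (Finset.Icc (n - k) n) ?_
  intro t t' h
  exact (reachIn_congr (graph_adj_congr fun j h1 h2 => h j (Finset.mem_Icc.2 ⟨h1.le, h2⟩))).1

theorem measurableSet_acyclicIn (n : ℤ) :
    MeasurableSet {t : Config | AcyclicIn (graph t) (Iic n)} := by
  simp only [acyclicIn_Iic, ofPred_forall]
  refine MeasurableSet.iInter fun k => measurableSet_of_dependsOn (Finset.Icc (n - k) n) ?_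
  intro t t' h
  exact (acyclicIn_congr (graph_adj_congr fun j h1 h2 => h j (Finset.mem_Icc.2 ⟨h1.le, h2⟩))).1

theorem measurableSet_gamma (n : ℤ) (i : Fin 5) : MeasurableSet (Gamma n i) := by
  have : Gamma n i = {t | ForestOn t (Iic n) n i} := by ext t; exact mem_gamma_iff
  rw [this]
  refine (measurableSet_acyclicIn n).inter (MeasurableSet.inter ?_ ?_)
  · change MeasurableSet {t : Config | ∀ v ∈ Iic n, _}
    simp only [ofPred_forall]
    exact MeasurableSet.iInter fun v => MeasurableSet.iInter fun _ =>
      (measurableSet_reachIn _ _ _).union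
        ((measurableSet_reachIn _ _ _).union (measurableSet_reachIn _ _ _))
  · have hm := measurableSet_reachIn n
    fin_cases i
    · exact (hm _ _).inter (hm _ _)
    · exact (hm _ _).compl.inter (hm _ _)
    · exact (hm _ _).inter (hm _ _).compl
    · exact (hm _ _).compl.inter (hm _ _)
    · exact (hm _ _).compl.inter ((hm _ _).compl.inter (hm _ _).compl)

theorem measurable_forestType (n : ℤ) : Measurable fun t => forestType t n := by
  refine measurable_to_countable' fun i => ?_
  have : (fun t => forestType t n) ⁻¹' {i} =
      Gamma n i ∪ ((⋃ j, Gamma n j)ᶜ ∩ {_t | i = 0}) := by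
    ext t
    simp only [mem_preimage, mem_singleton_iff, mem_union, mem_inter_iff, mem_compl_iff,
      mem_iUnion, Set.mem_ofPred_eq]
    by_cases h : ∃ j, t ∈ Gamma n j
    · obtain ⟨j, hj⟩ := h
      rw [forestType_eq (mem_gamma_iff.1 hj)]
      constructor
      · rintro rfl; exact .inl hj
      · rintro (h | h)
        · exact (mem_gamma_iff.1 hj).eq (mem_gamma_iff.1 h)
        · exact (h.1 ⟨j, hj⟩).elim
    · rw [forestType, dif_neg h]
      constructor
      · rintro rfl; exact .inr ⟨h, rfl⟩
      · rintro (h' | h')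
        · exact (h ⟨i, h'⟩).elim
        · exact h'.2.symm
  rw [this]
  exact (measurableSet_gamma n i).union
    ((MeasurableSet.iUnion fun j => measurableSet_gamma n j).compl.inter (MeasurableSet.const _))

theorem measurable_Y (n : ℤ) : Measurable (Y n) := by
  have h : Measurable (code n) :=
    (measurable_fst.comp (measurable_pi_apply n)).prodMk
      ((measurable_snd.comp (measurable_pi_apply n)).prodMk (measurable_forestType n))
  exact (measurable_of_countable (Function.invFun symbol)).comp h


/-! ### Powers of primitive matrices -/

open Matrix in
/-- If a nonnegative matrix with positive left and right eigenvectors `u`, `v` for the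
eigenvalue `1` has a power with positive entries, then its powers tend to the projection `v uᵀ`. -/
theorem tendsto_pow_of_primitive {ι : Type*} [Fintype ι] [DecidableEq ι] (A : Matrix ι ι ℝ)
    (u v : ι → ℝ) (hA : ∀ i j, 0 ≤ A i j) (hv : A *ᵥ v = v) (hu : u ᵥ* A = u)
    (hv0 : ∀ i, 0 < v i) (hu0 : ∀ i, 0 < u i) (huv : u ⬝ᵥ v = 1) (L : ℕ) (hL0 : 0 < L)
    (hL : ∀ i j, 0 < (A ^ L) i j) (i j : ι) :
    Filter.Tendsto (fun k => (A ^ k) i j) Filter.atTop (nhds (v i * u j)) := by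
  have hpow_nonneg : ∀ B : Matrix ι ι ℝ, (∀ i j, 0 ≤ B i j) → ∀ k i j, 0 ≤ (B ^ k) i j := by
    intro B hB k
    induction k with
    | zero => intro i j; rw [pow_zero, one_apply]; split_ifs <;> norm_num
    | succ k ih =>
      intro i j
      rw [pow_succ, mul_apply]
      exact Finset.sum_nonneg fun l _ => mul_nonneg (ih i l) (hB l j)
  have hpow_fix : ∀ B : Matrix ι ι ℝ, B *ᵥ v = v → ∀ k, B ^ k *ᵥ v = v := by
    intro B hB k
    induction k with
    | zero => simp
    | succ k ih => rw [pow_succ, ← mulVec_mulVec, hB, ih]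
  set Q : Matrix ι ι ℝ := vecMulVec v u with hQ
  have hQapp : ∀ i j, Q i j = v i * u j := fun i j => by rw [hQ, vecMulVec_apply]
  have hQl : ∀ B : Matrix ι ι ℝ, B *ᵥ v = v → B * Q = Q := fun B hB => by
    rw [hQ, mul_vecMulVec, hB]
  have hQA : Q * A = Q := by rw [hQ, vecMulVec_mul, hu]
  have hQv : Q *ᵥ v = v := by
    ext i
    simp only [mulVec, dotProduct, hQapp, mul_assoc, ← Finset.mul_sum]
    have : ∑ j, u j * v j = 1 := huv
    rw [this, mul_one]
  have hQApow : ∀ k, Q * A ^ k = Q := by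
    intro k
    induction k with
    | zero => simp
    | succ k ih => rw [pow_succ, ← mul_assoc, ih, hQA]
  -- Doeblin minorization of `A ^ L` by a multiple of the limit `Q`. The cap `1 / 2` keeps `c < 1`,
  -- so that the remainder can be normalized to `S`, which again fixes `v`.
  obtain ⟨c, hc0, hc1, hc⟩ : ∃ c : ℝ, 0 < c ∧ c < 1 ∧ ∀ i j, c * Q i j ≤ (A ^ L) i j := by
    have : Nonempty (ι × ι) := ⟨(i, j)⟩
    obtain ⟨p, hp⟩ := Finite.exists_min fun p : ι × ι => (A ^ L) p.1 p.2 / Q p.1 p.2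
    have hQ0 : ∀ i j, 0 < Q i j := fun i j => by rw [hQapp]; exact mul_pos (hv0 i) (hu0 j)
    refine ⟨min ((A ^ L) p.1 p.2 / Q p.1 p.2) (1 / 2), ?_, ?_, fun i j => ?_⟩
    · exact lt_min (div_pos (hL _ _) (hQ0 _ _)) (by norm_num)
    · exact (min_le_right _ _).trans_lt (by norm_num)
    · rw [← le_div_iff₀ (hQ0 i j)]
      exact (min_le_left _ _).trans (hp (i, j))
  have hc1' : (1 - c) ≠ 0 := by linarith
  set S : Matrix ι ι ℝ := (1 - c)⁻¹ • (A ^ L - c • Q) with hS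
  have hAS : A ^ L = (1 - c) • S + c • Q := by
    rw [hS, smul_smul, mul_inv_cancel₀ hc1', one_smul, sub_add_cancel]
  have hS0 : ∀ i j, 0 ≤ S i j := by
    intro i j
    have := hc i j
    simp only [hS, Matrix.smul_apply, Matrix.sub_apply, smul_eq_mul]
    exact mul_nonneg (inv_nonneg.2 (by linarith)) (by linarith)
  have hSv : S *ᵥ v = v := by
    rw [hS, smul_mulVec, sub_mulVec, smul_mulVec, hQv, hpow_fix A hv]
    ext i
    simp only [Pi.smul_apply, Pi.sub_apply, smul_eq_mul]
    field_simp
  clear_value S Q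
  -- `Q` absorbs `S` from both sides, so each block of length `L` shrinks the deviation from `Q` by
  -- the factor `1 - c`.
  have hkey : ∀ q : ℕ, (A ^ L) ^ q - Q = (1 - c) ^ q • (S ^ q - Q) := by
    intro q
    induction q with
    | zero => simp
    | succ q ih =>
      have h1 : (A ^ L) ^ (q + 1) - Q = ((A ^ L) ^ q - Q) * A ^ L := by
        rw [sub_mul, hQApow, pow_succ]
      have h2 : Q * S = Q := by
        have : Q * A ^ L = Q := hQApow L
        rw [hAS, mul_add, Matrix.mul_smul, Matrix.mul_smul, hQl Q hQv] at this
        have h3 : (1 - c) • (Q * S) = (1 - c) • Q := by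
          rw [sub_smul 1 c Q, one_smul]; exact eq_sub_of_add_eq this
        exact smul_right_injective _ hc1' h3
      have h3 : (S ^ q - Q) * A ^ L = (1 - c) • (S ^ (q + 1) - Q) := by
        rw [hAS, mul_add, Matrix.mul_smul, Matrix.mul_smul, sub_mul, sub_mul, hQl Q hQv,
          hQl _ (hpow_fix S hSv q), sub_self, smul_zero, add_zero, h2, ← pow_succ]
      rw [h1, ih, smul_mul_assoc, h3, smul_smul, ← pow_succ]
  have hbound : ∀ k, |(A ^ k) i j - v i * u j| ≤ (1 - c) ^ (k / L) * (v i / v j + v i * u j) := by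
    intro k
    -- `T` is nonnegative and fixes `v`, which bounds its entries by `v i / v j` uniformly in `k`.
    set T := A ^ (k % L) * S ^ (k / L) with hT
    have hT0 : ∀ i j, 0 ≤ T i j := fun i j => by
      rw [hT, mul_apply]
      exact Finset.sum_nonneg fun l _ => mul_nonneg (hpow_nonneg A hA _ _ _) (hpow_nonneg S hS0 _ _ _)
    have hTv : T *ᵥ v = v := by rw [hT, ← mulVec_mulVec, hpow_fix S hSv, hpow_fix A hv]
    have hTle : T i j ≤ v i / v j := by
      rw [le_div_iff₀ (hv0 j)]
      have h1 := congrFun hTv i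
      simp only [mulVec, dotProduct] at h1
      rw [← h1]
      exact Finset.single_le_sum (f := fun l => T i l * v l)
        (fun l _ => mul_nonneg (hT0 i l) (hv0 l).le) (Finset.mem_univ j)
    have h1 : A ^ k - Q = (1 - c) ^ (k / L) • (T - Q) := by
      have : A ^ k = A ^ (k % L) * (A ^ L) ^ (k / L) := by
        rw [← pow_mul, ← pow_add, Nat.mod_add_div]
      have h2 : A ^ k - Q = A ^ (k % L) * ((A ^ L) ^ (k / L) - Q) := by
        rw [mul_sub, hQl _ (hpow_fix A hv _), this]
      rw [h2, hkey, Matrix.mul_smul, mul_sub, hQl _ (hpow_fix A hv _)]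
    have h2 : (A ^ k) i j - v i * u j = (1 - c) ^ (k / L) * (T i j - v i * u j) := by
      have := congrFun (congrFun h1 i) j
      simpa only [Matrix.sub_apply, Matrix.smul_apply, smul_eq_mul, hQapp] using this
    rw [h2, abs_mul, abs_of_nonneg (pow_nonneg (by linarith) _)]
    refine mul_le_mul_of_nonneg_left ?_ (pow_nonneg (by linarith) _)
    have h3 : 0 < v i * u j := mul_pos (hv0 i) (hu0 j)
    have h4 := hT0 i j
    rw [abs_le]
    constructor <;> linarith
  rw [tendsto_iff_norm_sub_tendsto_zero]
  refine squeeze_zero (fun _ => norm_nonneg _) (fun k => hbound k) ?_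
  rw [← zero_mul (v i / v j + v i * u j)]
  refine Filter.Tendsto.mul_const _ ?_
  exact (tendsto_pow_atTop_nhds_zero_of_lt_one (by linarith) (by linarith)).comp
    (Nat.tendsto_div_const_atTop hL0.ne')

/-! ### The number `√γ` -/

/-- The square root of the golden ratio. -/
noncomputable def sg : ℝ := √γ

theorem sg_sq : sg ^ 2 = γ := Real.sq_sqrt Real.goldenRatio_pos.le

/-- All constants of the theorem are rational expressions in `sg`; their identities are checked by
reducing powers of `sg` with this relation. -/
theorem sg_pow_four : sg ^ 4 = sg ^ 2 + 1 := by
  have := Real.goldenRatio_sq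
  rw [show sg ^ 4 = (sg ^ 2) ^ 2 by ring, sg_sq, this]

theorem sg_pos : 0 < sg := Real.sqrt_pos.2 Real.goldenRatio_pos

/-- The decimal bounds serve only to decide signs: positivity of the eigenvectors, and `2 - √γ ≠ 0`.
-/
theorem lt_sg : 1.27 < sg := by
  have h := sg_pow_four
  have h0 := sg_pos
  by_contra hlt
  push Not at hlt
  have h2 : sg ^ 2 ≤ 1.27 ^ 2 := by gcongr
  nlinarith [mul_self_nonneg (sg ^ 2)]

theorem sg_lt : sg < 1.273 := by
  have h := sg_pow_four
  have h0 := sg_pos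
  by_contra hlt
  push Not at hlt
  have h2 : 1.273 ^ 2 ≤ sg ^ 2 := by gcongr
  nlinarith

theorem sqrt_five_eq : √5 = 2 * sg ^ 2 - 1 := by
  rw [sg_sq]
  simp only [γ, Real.goldenRatio]
  ring

theorem gamma_rpow_three_halves : γ ^ (3 / 2 : ℝ) = sg ^ 3 := by
  rw [show (3 / 2 : ℝ) = (1 / 2 : ℝ) * (3 : ℕ) by norm_num, Real.rpow_mul_natCast
    Real.goldenRatio_pos.le, ← Real.sqrt_eq_rpow, sg]

theorem gamma_rpow_five_halves : γ ^ (5 / 2 : ℝ) = sg ^ 5 := by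
  rw [show (5 / 2 : ℝ) = (1 / 2 : ℝ) * (5 : ℕ) by norm_num, Real.rpow_mul_natCast
    Real.goldenRatio_pos.le, ← Real.sqrt_eq_rpow, sg]

theorem sg_inv : sg⁻¹ = sg ^ 3 - sg := by
  rw [inv_eq_of_mul_eq_one_right]
  linear_combination sg_pow_four

theorem gamma_inv : γ⁻¹ = sg ^ 2 - 1 := by
  rw [← sg_sq, inv_eq_of_mul_eq_one_right]
  linear_combination sg_pow_four

/-! ### The matrix of the type transitions and its eigenvectors -/

/-- The type of the forest after a symbol. -/
def symbolType (k : Fin 11) : Fin 5 := (symbol k).2.2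

/-- The two edges added by a symbol. -/
def letter (k : Fin 11) : Bool × Bool := ((symbol k).1, (symbol k).2.1)

/-- The symbol `k` may follow a forest of type `i`. -/
def Legal (i : Fin 5) (k : Fin 11) : Prop := step i (letter k) = some (symbolType k)

instance (i : Fin 5) (k : Fin 11) : Decidable (Legal i k) := by unfold Legal; infer_instance

/-- The transition matrix between forest types, counting the legal symbols in `C`. -/
noncomputable def typeCount (C : Set (Fin 11)) : Matrix (Fin 5) (Fin 5) ℝ := fun i j =>
  ∑ k, if Legal i k ∧ symbolType k = j then C.indicator 1 k else 0

/-- The growth rate `γ + √γ` of the number of spanning trees. -/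
noncomputable def lam : ℝ := sg ^ 2 + sg

/-- The right eigenvector of the matrix of type transitions. -/
noncomputable def rv : Fin 5 → ℝ :=
  ![1, sg ^ 2 + sg - 2, 1 + sg - sg ^ 2, 2 * sg ^ 3 - 2 * sg - 1, sg ^ 2 - sg]

/-- The left eigenvector of the matrix of type transitions. -/
noncomputable def lv : Fin 5 → ℝ :=
  ![(1 + 2 * sg + 3 * sg ^ 2 + sg ^ 3) / 20, (-1 - sg + 2 * sg ^ 2 + 2 * sg ^ 3) / 20,
    (3 - sg - sg ^ 2 + 2 * sg ^ 3) / 20, (3 * sg - sg ^ 3) / 20, (2 + sg ^ 2) / 20]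

theorem lam_pos : 0 < lam := by have := sg_pos; unfold lam; positivity

theorem sg_sq_bounds : 1.61 < sg ^ 2 ∧ sg ^ 2 < 1.6206 := by
  have h1 := lt_sg
  have h2 := sg_lt
  constructor <;> nlinarith

theorem sg_cube_eq : 2.044 < sg ^ 3 ∧ sg ^ 3 < 2.0631 := by
  have h1 := lt_sg
  have h2 := sg_lt
  obtain ⟨h3, h4⟩ := sg_sq_bounds
  constructor <;> nlinarith

theorem rv_pos (i : Fin 5) : 0 < rv i := by
  have h1 := lt_sg
  have h2 := sg_lt
  obtain ⟨h3, h4⟩ := sg_sq_bounds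
  obtain ⟨h5, h6⟩ := sg_cube_eq
  fin_cases i <;> simp [rv] <;> nlinarith

theorem lv_pos (i : Fin 5) : 0 < lv i := by
  have h1 := lt_sg
  have h2 := sg_lt
  obtain ⟨h3, h4⟩ := sg_sq_bounds
  obtain ⟨h5, h6⟩ := sg_cube_eq
  fin_cases i <;> simp [lv] <;> nlinarith

theorem typeCount_univ : typeCount univ = !![2, 1, 0, 0, 0; 1, 0, 1, 1, 1; 1, 1, 0, 0, 0;
    0, 0, 2, 0, 1; 0, 0, 1, 0, 1] := by
  have h : ∀ i j, typeCount univ i j =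
      ((Finset.univ.filter fun k => Legal i k ∧ symbolType k = j).card : ℝ) := by
    intro i j
    simp [typeCount]
  have h2 : ∀ i j : Fin 5, (Finset.univ.filter fun k : Fin 11 => Legal i k ∧ symbolType k = j).card =
      (![![2, 1, 0, 0, 0], ![1, 0, 1, 1, 1], ![1, 1, 0, 0, 0], ![0, 0, 2, 0, 1],
        ![0, 0, 1, 0, 1]] : Fin 5 → Fin 5 → ℕ) i j := by decide
  ext i j
  rw [h, h2]
  fin_cases i <;> fin_cases j <;> simp

theorem typeCount_univ_mulVec_rv : (typeCount univ).mulVec rv = lam • rv := by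
  have h := sg_pow_four
  have h5 : sg ^ 5 = sg ^ 3 + sg := by linear_combination sg * h
  rw [typeCount_univ]
  ext i
  fin_cases i <;> simp [Matrix.mulVec, dotProduct, Fin.sum_univ_succ, rv, lam] <;> ring_nf <;>
    simp only [h, h5] <;> ring

theorem lv_vecMul_typeCount_univ : Matrix.vecMul lv (typeCount univ) = lam • lv := by
  have h := sg_pow_four
  have h5 : sg ^ 5 = sg ^ 3 + sg := by linear_combination sg * h
  rw [typeCount_univ]
  ext i
  fin_cases i <;> simp [Matrix.vecMul, dotProduct, Fin.sum_univ_succ, lv, lam] <;> ring_nf <;>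
    simp only [h, h5] <;> ring

theorem lv_dotProduct_rv : dotProduct lv rv = 1 := by
  have h := sg_pow_four
  have h6 : sg ^ 6 = 2 * sg ^ 2 + 1 := by linear_combination (sg ^ 2 + 1) * h
  simp [dotProduct, Fin.sum_univ_succ, lv, rv]
  ring_nf
  simp only [h, h6]
  ring

theorem typeCount_nonneg (C : Set (Fin 11)) (i j : Fin 5) : 0 ≤ typeCount C i j := by
  refine Finset.sum_nonneg fun k _ => ?_
  split_ifs
  · exact indicator_nonneg (fun _ _ => zero_le_one) _
  · exact le_rfl

/-- The normalized transition matrix of the forest types. -/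
noncomputable def normCount (C : Set (Fin 11)) : Matrix (Fin 5) (Fin 5) ℝ := lam⁻¹ • typeCount C

theorem normCount_nonneg (C : Set (Fin 11)) (i j : Fin 5) : 0 ≤ normCount C i j :=
  mul_nonneg (inv_nonneg.2 lam_pos.le) (typeCount_nonneg C i j)

theorem normCount_univ_mulVec_rv : (normCount univ).mulVec rv = rv := by
  rw [normCount, Matrix.smul_mulVec, typeCount_univ_mulVec_rv, smul_smul,
    inv_mul_cancel₀ lam_pos.ne', one_smul]

theorem lv_vecMul_normCount_univ : Matrix.vecMul lv (normCount univ) = lv := by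
  rw [normCount, Matrix.vecMul_smul, lv_vecMul_typeCount_univ, smul_smul,
    inv_mul_cancel₀ lam_pos.ne', one_smul]

/-- Primitivity, decided on the matrix of natural numbers. The square would not do: its entry at
`(1, 3)` vanishes. -/
theorem normCount_univ_pow_three_pos (i j : Fin 5) : 0 < (normCount univ ^ 3) i j := by
  rw [normCount, smul_pow, Matrix.smul_apply, smul_eq_mul]
  refine mul_pos (pow_pos (inv_pos.2 lam_pos) 3) ?_
  let N : Matrix (Fin 5) (Fin 5) ℕ :=
    !![2, 1, 0, 0, 0; 1, 0, 1, 1, 1; 1, 1, 0, 0, 0; 0, 0, 2, 0, 1; 0, 0, 1, 0, 1]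
  have hN : typeCount univ = N.map (Nat.castRingHom ℝ) := by
    rw [typeCount_univ]
    ext i j
    fin_cases i <;> fin_cases j <;> simp [N]
  have h : ∀ i j, 0 < (N * N * N) i j := by decide
  rw [hN, ← Matrix.map_pow, Matrix.map_apply, pow_succ, pow_two]
  simpa using h i j

theorem tendsto_normCount_univ_pow (i j : Fin 5) :
    Filter.Tendsto (fun k => (normCount univ ^ k) i j) Filter.atTop (nhds (rv i * lv j)) :=
  tendsto_pow_of_primitive _ lv rv (normCount_nonneg _) normCount_univ_mulVec_rv
    lv_vecMul_normCount_univ rv_pos lv_pos lv_dotProduct_rv 3 (by norm_num)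
    normCount_univ_pow_three_pos i j

/-! ### The transition matrix of the process -/

theorem R_row (i : Fin 11) : R i =
    (![![typeMatrix 0 0 / 2, typeMatrix 0 0 / 2, 0, typeMatrix 0 1, 0, 0, 0, 0, 0, 0, 0],
      ![0, 0, typeMatrix 1 0, 0, 0, typeMatrix 1 2, 0, 0, typeMatrix 1 3, typeMatrix 1 4, 0],
      ![0, 0, typeMatrix 2 0, 0, typeMatrix 2 1, 0, 0, 0, 0, 0, 0],
      ![0, 0, 0, 0, 0, typeMatrix 3 2 / 2, typeMatrix 3 2 / 2, 0, 0, typeMatrix 3 4, 0],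
      ![0, 0, 0, 0, 0, 0, 0, typeMatrix 4 2, 0, 0, typeMatrix 4 4]] :
      Fin 5 → Fin 11 → ℝ) (symbolType i) := by
  fin_cases i <;> rfl

/-- The explicit constants are the Doob transform of the counting matrix by `rv`, stated without
division so that each entry becomes an identity between powers of `sg`. -/
theorem typeMatrix_mul (i j : Fin 5) :
    typeMatrix i j * (lam * rv i) = typeCount univ i j * rv j := by
  have h := sg_pow_four
  have h5 : sg ^ 5 = sg ^ 3 + sg := by linear_combination sg * h
  have h6 : sg ^ 6 = 2 * sg ^ 2 + 1 := by linear_combination (sg ^ 2 + 1) * h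
  have h7 : sg ^ 7 = 2 * sg ^ 3 + sg := by linear_combination (sg ^ 3 + sg) * h
  have h8 : sg ^ 8 = 3 * sg ^ 2 + 2 := by linear_combination (sg ^ 4 + sg ^ 2 + 2) * h
  have h9 : sg ^ 9 = 3 * sg ^ 3 + 2 * sg := by linear_combination sg * h8
  have h10 : sg ^ 10 = 5 * sg ^ 2 + 3 := by linear_combination sg ^ 2 * h8 + 3 * h
  have e : √γ = sg := rfl
  have eg : γ = sg ^ 2 := sg_sq.symm
  have hs := sg_pos.ne'
  have a1 : 2 + sg ≠ 0 := by have := sg_pos; positivity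
  have a3 : 1 + sg ≠ 0 := by have := sg_pos; positivity
  have a2 : 2 - sg ≠ 0 := by have := sg_lt; intro h; linarith
  have e3 : (1 + sg)⁻¹ = sg ^ 3 - sg ^ 2 := by
    rw [inv_eq_of_mul_eq_one_right]; linear_combination h
  rw [typeCount_univ]
  fin_cases i <;> fin_cases j <;>
    simp [typeMatrix, rv, lam, gamma_rpow_three_halves, gamma_rpow_five_halves, e] <;>
    (try rw [eg]) <;> (try rw [sqrt_five_eq]) <;> field_simp <;> ring_nf <;>
    (try (simp only [e3]; ring_nf)) <;>
    (try simp only [h, h5, h6, h7, h8, h9, h10]) <;> (try ring)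

/-- From here on the explicit entries of `R` play no role: its properties follow from this form and
the eigenvector equations. -/
theorem R_apply (i k : Fin 11) : R i k =
    if Legal (symbolType i) k then rv (symbolType k) / (lam * rv (symbolType i)) else 0 := by
  have hpos : ∀ i, lam * rv i ≠ 0 := fun i => (mul_pos lam_pos (rv_pos i)).ne'
  rw [R_row]
  generalize symbolType i = i
  -- `c` is the number of symbols leading from type `i` to type `j`; they share the type transition
  -- probability equally.
  have key : ∀ (j : Fin 5) (x c : ℝ), typeCount univ i j = c → c ≠ 0 → typeMatrix i j / c = x →
      x = rv j / (lam * rv i) := by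
    rintro j x c rfl hc rfl
    rw [eq_div_iff (hpos i), div_mul_eq_mul_div, typeMatrix_mul, mul_div_assoc,
      mul_div_cancel₀ _ hc]
  have hL : ∀ (i : Fin 5) (k : Fin 11), decide (Legal i k) = (![
    ![true, true, false, true, false, false, false, false, false, false, false],
    ![false, false, true, false, false, true, false, false, true, true, false],
    ![false, false, true, false, true, false, false, false, false, false, false],
    ![false, false, false, false, false, true, true, false, false, true, false],
    ![false, false, false, false, false, false, false, true, false, false, true]]
    : Fin 5 → Fin 11 → Bool) i k := by decide
  have hL' := hL i k
  clear hL
  by_cases hl : Legal i k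
  · rw [if_pos hl]
    rw [decide_eq_true hl] at hL'
    rw [typeCount_univ] at key
    fin_cases i <;> fin_cases k <;> first
      | exact absurd hL' (by decide)
      | exact key _ _ 2 rfl two_ne_zero rfl
      | exact key _ _ 1 rfl one_ne_zero (div_one _)
  · rw [if_neg hl]
    rw [decide_eq_false hl] at hL'
    fin_cases i <;> fin_cases k <;> first
      | rfl
      | exact absurd hL' (by decide)

/-! ### The invariant distribution and the entropy -/

theorem sum_legal (i : Fin 5) (f : Fin 5 → ℝ) :
    (∑ k, if Legal i k then f (symbolType k) else 0) = ∑ j, typeCount univ i j * f j := by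
  simp only [typeCount, Finset.sum_mul]
  rw [Finset.sum_comm]
  refine Finset.sum_congr rfl fun k _ => ?_
  by_cases h : Legal i k <;> simp [h]

theorem sum_R (i : Fin 11) : ∑ k, R i k = 1 := by
  simp only [R_apply]
  rw [sum_legal (symbolType i) fun j => rv j / (lam * rv (symbolType i))]
  have h := congrFun typeCount_univ_mulVec_rv (symbolType i)
  simp only [Matrix.mulVec, dotProduct, Pi.smul_apply, smul_eq_mul] at h
  simp only [← mul_div_assoc]
  rw [← Finset.sum_div, h, div_self (mul_pos lam_pos (rv_pos _)).ne']

theorem R_nonneg (i k : Fin 11) : 0 ≤ R i k := by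
  rw [R_apply]
  split_ifs
  · exact (div_pos (rv_pos _) (mul_pos lam_pos (rv_pos _))).le
  · exact le_rfl

theorem R_mem_rowStochastic : R ∈ Matrix.rowStochastic ℝ (Fin 11) := by
  rw [Matrix.mem_rowStochastic_iff_sum]
  exact ⟨R_nonneg, sum_R⟩

/-- The law of a symbol that follows a type, given the weights `θ` of the types. -/
noncomputable def symbolLaw (θ : Fin 5 → ℝ) (k : Fin 11) : ℝ :=
  (∑ i, if Legal i k then θ i else 0) * rv (symbolType k) * lam⁻¹

/-- The weights of the types, given the law of a symbol. -/
noncomputable def typeWeight (ν : Fin 11 → ℝ) (j : Fin 5) : ℝ :=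
  ∑ k, if symbolType k = j then ν k / rv j else 0

/-- A row of `R` depends only on the type of the current symbol, so `R` factors through the weights
of the types. Composing the two factors in the other order gives `normCount univ`
(`typeWeight_symbolLaw`), so invariant vectors of `R` correspond to left fixed vectors of that
matrix. -/
theorem vecMul_R (ν : Fin 11 → ℝ) : Matrix.vecMul ν R = symbolLaw (typeWeight ν) := by
  ext k
  simp only [Matrix.vecMul, dotProduct, symbolLaw, typeWeight, R_apply]
  have : ∀ i : Fin 5, (if Legal i k then ∑ l, if symbolType l = i then ν l / rv i else 0 else 0) =
      ∑ l, if symbolType l = i then (if Legal i k then ν l / rv i else 0) else 0 := by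
    intro i
    by_cases h : Legal i k <;> simp [h]
  simp only [this]
  rw [Finset.sum_comm, Finset.sum_mul, Finset.sum_mul]
  refine Finset.sum_congr rfl fun l _ => ?_
  rw [Finset.sum_ite_eq Finset.univ (symbolType l), if_pos (Finset.mem_univ _)]
  have := (rv_pos (symbolType l)).ne'
  have := lam_pos.ne'
  split_ifs
  · field_simp
  · simp

theorem typeWeight_symbolLaw (θ : Fin 5 → ℝ) :
    typeWeight (symbolLaw θ) = Matrix.vecMul θ (normCount univ) := by
  ext j
  simp only [typeWeight, symbolLaw, Matrix.vecMul, dotProduct, normCount, Matrix.smul_apply,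
    typeCount, smul_eq_mul, Finset.mul_sum]
  rw [Finset.sum_comm]
  refine Finset.sum_congr rfl fun k _ => ?_
  have := (rv_pos j).ne'
  by_cases h : symbolType k = j
  · subst h
    simp only [if_true, and_true]
    rw [mul_div_right_comm, mul_div_assoc, div_self this, mul_one, Finset.sum_mul]
    refine Finset.sum_congr rfl fun i _ => ?_
    by_cases h : Legal i k <;> simp [h]
  · simp [h]

theorem lam_inv : lam⁻¹ = sg ^ 2 - sg := by
  rw [inv_eq_of_mul_eq_one_right]
  unfold lam
  linear_combination sg_pow_four

theorem one_div_four_sqrt_five : 1 / (4 * √5) = (2 * sg ^ 2 - 1) / 20 := by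
  have h : √5 * √5 = 5 := Real.mul_self_sqrt (by norm_num)
  have h0 : √5 ≠ 0 := by positivity
  rw [← sqrt_five_eq]
  field_simp
  linarith

theorem invDist_eq : invDist = symbolLaw lv := by
  have h := sg_pow_four
  have h5 : sg ^ 5 = sg ^ 3 + sg := by linear_combination sg * h
  have h6 : sg ^ 6 = 2 * sg ^ 2 + 1 := by linear_combination (sg ^ 2 + 1) * h
  have h7 : sg ^ 7 = 2 * sg ^ 3 + sg := by linear_combination (sg ^ 3 + sg) * h
  have h8 : sg ^ 8 = 3 * sg ^ 2 + 2 := by linear_combination (sg ^ 4 + sg ^ 2 + 2) * h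
  have h10 : sg ^ 10 = 5 * sg ^ 2 + 3 := by linear_combination sg ^ 2 * h8 + 3 * h
  have e : √γ = sg := rfl
  have eg : γ = sg ^ 2 := sg_sq.symm
  ext k
  rw [invDist, symbolLaw, one_div_four_sqrt_five, lam_inv]
  simp only [gamma_rpow_three_halves, gamma_rpow_five_halves, gamma_inv, e, one_div, sg_inv,
    sqrt_five_eq]
  fin_cases k <;>
    simp [Fin.sum_univ_succ, Legal, symbolType, letter, symbol, step, lv, rv] <;>
    (try rw [eg]) <;> ring_nf <;> simp only [h, h5, h6, h7, h8, h10] <;> ring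

theorem typeWeight_invDist : typeWeight invDist = lv := by
  rw [invDist_eq, typeWeight_symbolLaw, lv_vecMul_normCount_univ]

theorem vecMul_invDist : Matrix.vecMul invDist R = invDist := by
  rw [vecMul_R, typeWeight_invDist, invDist_eq]

theorem sum_typeWeight (ν : Fin 11 → ℝ) : ∑ j, typeWeight ν j * rv j = ∑ k, ν k := by
  simp only [typeWeight, Finset.sum_mul]
  rw [Finset.sum_comm]
  refine Finset.sum_congr rfl fun k _ => ?_
  rw [Finset.sum_eq_single (symbolType k)]
  · rw [if_pos rfl, div_mul_cancel₀ _ (rv_pos _).ne']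
  · intro j _ hj
    rw [if_neg (Ne.symm hj), zero_mul]
  · simp

theorem sum_invDist : ∑ k, invDist k = 1 := by
  rw [← sum_typeWeight, typeWeight_invDist]
  exact lv_dotProduct_rv

/-- `θ` is fixed by all powers, hence by their limit `rv lvᵀ`, which maps it to a multiple of `lv`.
-/
theorem eq_lv_of_vecMul_eq {θ : Fin 5 → ℝ} (h : Matrix.vecMul θ (normCount univ) = θ)
    (h1 : ∑ j, θ j * rv j = 1) : θ = lv := by
  have hk : ∀ k : ℕ, Matrix.vecMul θ (normCount univ ^ k) = θ := by
    intro k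
    induction k with
    | zero => simp
    | succ k ih => rw [pow_succ, ← Matrix.vecMul_vecMul, ih, h]
  ext j
  have ht : Filter.Tendsto (fun k : ℕ => ∑ i, θ i * (normCount univ ^ k) i j) Filter.atTop
      (nhds (∑ i, θ i * (rv i * lv j))) :=
    tendsto_finsetSum _ fun i _ => (tendsto_normCount_univ_pow i j).const_mul _
  have h2 : (fun k : ℕ => ∑ i, θ i * (normCount univ ^ k) i j) = fun _ => θ j := by
    ext k
    exact congrFun (hk k) j
  rw [h2] at ht
  rw [tendsto_nhds_unique tendsto_const_nhds ht]
  simp only [← mul_assoc]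
  rw [← Finset.sum_mul, h1, one_mul]

theorem vecMul_R_eq_iff {ν : Fin 11 → ℝ} (hν : ν ∈ stdSimplex ℝ (Fin 11)) :
    Matrix.vecMul ν R = ν ↔ ν = invDist := by
  refine ⟨fun h => ?_, fun h => h ▸ vecMul_invDist⟩
  have h1 : typeWeight ν = lv := by
    refine eq_lv_of_vecMul_eq ?_ ?_
    · rw [← typeWeight_symbolLaw, ← vecMul_R, h]
    · rw [sum_typeWeight]; exact hν.2
  rw [← h, vecMul_R, h1, invDist_eq]

theorem lam_eq : lam = γ + √γ := by rw [lam, sg_sq, sg]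

/-- On legal transitions `log (R i j)` is `-log lam` plus the difference of `log rv` at the two
types; by invariance that difference averages to zero. -/
theorem chainEntropy_invDist : chainEntropy invDist R = Real.log (γ + √γ) := by
  have h1 : ∀ i j, invDist i * R i j * Real.log (R i j) =
      (invDist i * R i j) * Real.log (rv (symbolType j)) -
        (invDist i * Real.log (rv (symbolType i))) * R i j - invDist i * Real.log lam * R i j := by
    intro i j
    rw [R_apply]
    split_ifs
    · rw [Real.log_div (rv_pos _).ne' (mul_pos lam_pos (rv_pos _)).ne',
        Real.log_mul lam_pos.ne' (rv_pos _).ne']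
      ring
    · simp
  have h2 : ∀ j, ∑ i, invDist i * R i j = invDist j := congrFun vecMul_invDist
  unfold chainEntropy
  simp only [h1, Finset.sum_sub_distrib, ← Finset.mul_sum, sum_R, mul_one]
  rw [Finset.sum_comm]
  simp only [← Finset.sum_mul, h2, sum_invDist]
  rw [lam_eq]
  ring


/-! ### Measures on sequences over a finite alphabet -/

/-- The sequences whose entries at the places in `(a, b]` lie in the given sets. -/
def box {F : Type*} (a b : ℤ) (C : ℤ → Set F) : Set (ℤ → F) :=
  {ω | ∀ k, a < k → k ≤ b → ω k ∈ C k}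

theorem isClopen_box {F : Type*} [TopologicalSpace F] [DiscreteTopology F] (a b : ℤ) (C : ℤ → Set F) : IsClopen (box a b C) := by
  have : box a b C = ⋂ k ∈ Ioc a b, (fun ω : ℤ → F => ω k) ⁻¹' C k := by
    ext ω; simp [box]
  rw [this]
  exact (finite_Ioc a b).isClopen_biInter fun k _ => (isClopen_discrete _).preimage (continuous_apply k)

section Boxes

variable {F : Type*} [MeasurableSpace F]

theorem measurableSet_box [Finite F] [MeasurableSingletonClass F] (a b : ℤ) (C : ℤ → Set F) : MeasurableSet (box a b C) :=
  measurableSet_of_dependsOn (Finset.Icc a b) fun _ _ h ht k h1 h2 =>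
    h k (Finset.mem_Icc.2 ⟨h1.le, h2⟩) ▸ ht k h1 h2

/-- Every cylinder over a finite set of places is a box over an interval containing them, with no
condition at the other places; the cylinders form a generating π-system. -/
theorem ext_of_box {μ ν : Measure (ℤ → F)} [IsProbabilityMeasure μ] [IsProbabilityMeasure ν]
    (h : ∀ (a : ℤ) (l : ℕ) (C : ℤ → Set F), μ.real (box a (a + l) C) = ν.real (box a (a + l) C)) :
    μ = ν := by
  refine ext_of_generate_finite (squareCylinders fun _ => {s | MeasurableSet s})
    generateFrom_squareCylinders.symm
    (isPiSystem_squareCylinders (fun _ => MeasurableSpace.isPiSystem_measurableSet)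
      fun _ => MeasurableSet.univ) ?_ (by simp)
  rintro _ ⟨I, C, -, rfl⟩
  classical
  obtain ⟨b, hb⟩ : ∃ b : ℕ, ∀ k ∈ I, -(b : ℤ) < k ∧ k ≤ b := by
    refine ⟨(∑ k ∈ I, k.natAbs) + 1, fun k hk => ?_⟩
    have := Finset.single_le_sum (f := fun k : ℤ => k.natAbs) (fun _ _ => Nat.zero_le _) hk
    beta_reduce at this
    omega
  have : (I : Set ℤ).pi C = box (-(b : ℤ)) (-(b : ℤ) + (2 * b : ℕ)) fun k =>
      if k ∈ I then C k else univ := by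
    ext ω
    simp only [box, Set.mem_pi, Finset.mem_coe, Set.mem_ofPred_eq]
    constructor
    · intro h k _ _
      split_ifs with hk
      · exact h k hk
      · trivial
    · intro h k hk
      have := h k (hb k hk).1 (by have := (hb k hk).2; push_cast; omega)
      rwa [if_pos hk] at this
  rw [this, ← ENNReal.toReal_eq_toReal_iff' (measure_ne_top _ _) (measure_ne_top _ _)]
  exact h _ _ _

variable [Finite F] [TopologicalSpace F] [DiscreteTopology F] [BorelSpace F]

/-- Boxes are clopen, so their frontier is empty and the portmanteau theorem applies to every
measure. -/
theorem continuous_real_box (a b : ℤ) (C : ℤ → Set F) :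
    Continuous fun ρ : ProbabilityMeasure (ℤ → F) => (ρ : Measure (ℤ → F)).real (box a b C) := by
  rw [continuous_iff_continuousAt]
  intro ρ
  have h := ProbabilityMeasure.tendsto_measure_of_null_frontier_of_tendsto
    (Filter.tendsto_id (x := nhds ρ)) (E := box a b C) (by
      rw [(isClopen_box a b C).frontier_eq]; simp)
  exact (NNReal.tendsto_coe.2 h)

/-- Probability measures whose values on all boxes converge have a weak limit. -/
theorem exists_tendsto_of_tendsto_box {μ : ℕ → ProbabilityMeasure (ℤ → F)}
    {c : ℤ → ℕ → (ℤ → Set F) → ℝ}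
    (h : ∀ a (l : ℕ) C, Filter.Tendsto (fun n => (μ n : Measure (ℤ → F)).real (box a (a + l) C))
      Filter.atTop (nhds (c a l C))) :
    ∃ ν : ProbabilityMeasure (ℤ → F), Filter.Tendsto μ Filter.atTop (nhds ν) ∧
      ∀ a (l : ℕ) C, (ν : Measure (ℤ → F)).real (box a (a + l) C) = c a l C := by
  have hval : ∀ ν, ClusterPt ν (Filter.map μ Filter.atTop) → ∀ a (l : ℕ) C,
      (ν : Measure (ℤ → F)).real (box a (a + l) C) = c a l C := by
    intro ν hν a l C
    have h1 : MapClusterPt ν Filter.atTop μ := hν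
    have h2 := h1.continuousAt_comp (continuous_real_box a (a + l) C).continuousAt
    have h3 : (nhds ((ν : Measure (ℤ → F)).real (box a (a + l) C)) ⊓ nhds (c a l C)).NeBot :=
      Filter.NeBot.mono h2 (inf_le_inf_left _ (h a l C))
    exact eq_of_nhds_neBot h3
  -- The space of probability measures is compact because the alphabet is finite, and all cluster
  -- points agree on boxes, hence coincide.
  obtain ⟨ν, hν⟩ := exists_clusterPt_of_compactSpace (Filter.map μ Filter.atTop)
  refine ⟨ν, le_nhds_of_unique_clusterPt fun ρ hρ => ?_, hval ν hν⟩
  refine Subtype.ext (@ext_of_box _ _ _ _ ρ.2 ν.2 fun a l C => ?_)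
  exact (hval ρ hρ a l C).trans (hval ν hν a l C).symm

end Boxes

/-! ### Products of type transition matrices -/

/-- The product of the normalized type transition matrices over the places `a + 1, …, a + l`, with
the symbols restricted to the given sets. -/
noncomputable def boxMat (a : ℤ) (C : ℤ → Set (Fin 11)) : ℕ → Matrix (Fin 5) (Fin 5) ℝ
  | 0 => 1
  | l + 1 => boxMat a C l * normCount (C (a + l + 1))

theorem boxMat_add (a : ℤ) (C : ℤ → Set (Fin 11)) (k l : ℕ) :
    boxMat a C (k + l) = boxMat a C k * boxMat (a + k) C l := by
  induction l with
  | zero => simp [boxMat]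
  | succ l ih =>
    rw [← add_assoc, boxMat, ih, boxMat, mul_assoc]
    push_cast
    simp only [add_assoc]

theorem boxMat_congr {a : ℤ} {C D : ℤ → Set (Fin 11)} {l : ℕ}
    (h : ∀ k, a < k → k ≤ a + l → C k = D k) : boxMat a C l = boxMat a D l := by
  induction l with
  | zero => rfl
  | succ l ih =>
    rw [boxMat, boxMat, ih fun k h1 h2 => h k h1 (by push_cast; omega),
      h _ (by omega) (by push_cast; omega)]

theorem boxMat_shift (a b : ℤ) (C : ℤ → Set (Fin 11)) (l : ℕ) :
    boxMat (a + b) C l = boxMat a (fun k => C (k + b)) l := by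
  induction l with
  | zero => rfl
  | succ l ih =>
    rw [boxMat, boxMat, ih]
    congr 3
    ring

theorem boxMat_univ (a : ℤ) (l : ℕ) : boxMat a (fun _ => univ) l = normCount univ ^ l := by
  induction l with
  | zero => simp [boxMat]
  | succ l ih => rw [boxMat, ih, pow_succ]

/-- The limiting probability of a box. -/
noncomputable def boxProb (a : ℤ) (l : ℕ) (C : ℤ → Set (Fin 11)) : ℝ :=
  dotProduct lv ((boxMat a C l).mulVec rv)

/-- Both outer powers become `rv lvᵀ`, so the limit splits into a factor from the left end, one from
the right end, and the middle factor `lv · B rv`. In quotients of counts only the middle one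
remains. -/
theorem tendsto_sandwich {ι : Type*} {f : Filter ι} (c : Fin 5 → ℝ) (B : Matrix (Fin 5) (Fin 5) ℝ)
    {k₁ k₂ : ι → ℕ} (h1 : Filter.Tendsto k₁ f Filter.atTop)
    (h2 : Filter.Tendsto k₂ f Filter.atTop) (j : Fin 5) :
    Filter.Tendsto (fun n => (Matrix.vecMul c
      (normCount univ ^ k₁ n * B * normCount univ ^ k₂ n)) j) f
      (nhds ((dotProduct c rv) * dotProduct lv (B.mulVec rv) * lv j)) := by
  have hA := fun i j => (tendsto_normCount_univ_pow i j).comp h1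
  have hB := fun i j => (tendsto_normCount_univ_pow i j).comp h2
  have e1 : ∀ n, (Matrix.vecMul c (normCount univ ^ k₁ n * B * normCount univ ^ k₂ n)) j =
      ∑ i, c i * ∑ q, (∑ p, (normCount univ ^ k₁ n) i p * B p q) *
        (normCount univ ^ k₂ n) q j := by
    intro n
    simp only [Matrix.vecMul, dotProduct, Matrix.mul_apply]
  have e2 : (dotProduct c rv) * dotProduct lv (B.mulVec rv) * lv j =
      ∑ i, c i * ∑ q, (∑ p, rv i * lv p * B p q) * (rv q * lv j) := by
    have e3 : ∀ i, ∑ q, (∑ p, rv i * lv p * B p q) * (rv q * lv j) =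
        rv i * (dotProduct lv (B.mulVec rv) * lv j) := by
      intro i
      simp only [dotProduct, Matrix.mulVec, Finset.sum_mul, Finset.mul_sum]
      rw [Finset.sum_comm]
      exact Finset.sum_congr rfl fun p _ => Finset.sum_congr rfl fun q _ => by ring
    have e4 : dotProduct c rv = ∑ i, c i * rv i := rfl
    rw [e4, mul_assoc, Finset.sum_mul]
    exact Finset.sum_congr rfl fun i _ => by rw [e3, mul_assoc]
  rw [e2]
  refine Filter.Tendsto.congr (fun n => (e1 n).symm) ?_
  exact tendsto_finsetSum _ fun i _ => (tendsto_finsetSum _ fun q _ =>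
    (tendsto_finsetSum _ fun p _ => (hA i p).mul_const _).mul (hB q j)).const_mul _


/-! ### Counting spanning trees of finite pieces -/

/-- Only edges within `[m, n]` occur in `t`. -/
def SupportedOn (m n : ℤ) (t : Config) : Prop := ∀ e ∈ edges t, ∀ v ∈ e, v ∈ Icc m n

theorem supportedOn_iff {m n : ℤ} {t : Config} : SupportedOn m n t ↔
    ∀ k, ((t k).1 = true → m ≤ k - 3 ∧ k ≤ n) ∧ ((t k).2 = true → m ≤ k - 1 ∧ k ≤ n) := by
  constructor
  · intro h k
    constructor
    · intro hk
      have h1 := h s(k - 3, k) ⟨k, .inl ⟨hk, rfl⟩⟩ (k - 3) (Sym2.mem_mk_left _ _)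
      have h2 := h s(k - 3, k) ⟨k, .inl ⟨hk, rfl⟩⟩ k (Sym2.mem_mk_right _ _)
      exact ⟨h1.1, h2.2⟩
    · intro hk
      have h1 := h s(k - 1, k) ⟨k, .inr ⟨hk, rfl⟩⟩ (k - 1) (Sym2.mem_mk_left _ _)
      have h2 := h s(k - 1, k) ⟨k, .inr ⟨hk, rfl⟩⟩ k (Sym2.mem_mk_right _ _)
      exact ⟨h1.1, h2.2⟩
  · rintro h e ⟨k, ⟨hk, rfl⟩ | ⟨hk, rfl⟩⟩ v hv
    · have := (h k).1 hk
      rcases Sym2.mem_iff.1 hv with rfl | rfl <;> constructor <;> omega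
    · have := (h k).2 hk
      rcases Sym2.mem_iff.1 hv with rfl | rfl <;> constructor <;> omega

theorem SupportedOn.eq_of_lt {m n : ℤ} {t : Config} (h : SupportedOn m n t) {k : ℤ}
    (hk : n < k) : t k = (false, false) := by
  have := supportedOn_iff.1 h k
  rcases hx : t k with ⟨_ | _, _ | _⟩
  · rfl
  all_goals (rw [hx] at this; simp at this; omega)

theorem SupportedOn.eq_of_le {m n : ℤ} {t : Config} (h : SupportedOn m n t) {k : ℤ}
    (hk : k ≤ m) : t k = (false, false) := by
  have := supportedOn_iff.1 h k
  rcases hx : t k with ⟨_ | _, _ | _⟩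
  · rfl
  all_goals (rw [hx] at this; simp at this; omega)

theorem finite_supportedOn (m n : ℤ) : {t | SupportedOn m n t}.Finite := by
  have hinj : InjOn (fun t : Config => (Finset.Icc m n).restrict t) {t | SupportedOn m n t} := by
    intro t ht t' ht' h
    funext k
    by_cases hk : k ∈ Finset.Icc m n
    · exact congrFun h ⟨k, hk⟩
    · rw [Finset.mem_Icc, not_and_or, not_le, not_le] at hk
      rcases hk with hk | hk
      · rw [SupportedOn.eq_of_le ht hk.le, SupportedOn.eq_of_le ht' hk.le]
      · rw [SupportedOn.eq_of_lt ht hk, SupportedOn.eq_of_lt ht' hk]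
  exact Finite.of_finite_image (toFinite _) hinj

/-- The type of the forest on `[m, k]`. -/
noncomputable def finiteType (m : ℤ) (t : Config) (k : ℤ) : Fin 5 :=
  Classical.epsilon fun i => ForestOn t (Icc m k) k i

theorem finiteType_eq {m : ℤ} {t : Config} {k : ℤ} {i : Fin 5} (h : ForestOn t (Icc m k) k i) :
    finiteType m t k = i :=
  (Classical.epsilon_spec (p := fun i => ForestOn t (Icc m k) k i) ⟨i, h⟩).eq h

/-- The sequence of symbols of a forest on a finite piece starting at `m`. -/
noncomputable def lift (m : ℤ) (t : Config) (k : ℤ) : Fin 11 :=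
  Function.invFun symbol ((t k).1, (t k).2, finiteType m t k)

theorem lift_eq {m : ℤ} {t : Config} {k : ℤ} {s : Fin 11}
    (h : symbol s = ((t k).1, (t k).2, finiteType m t k)) : lift m t k = s := by
  rw [lift, ← h, Function.leftInverse_invFun symbol_injective]

theorem lift_congr {m : ℤ} {t t' : Config} {n : ℤ} (h : ∀ k, m < k → k ≤ n → t k = t' k) {k : ℤ}
    (h1 : m < k) (h2 : k ≤ n) : lift m t k = lift m t' k := by
  have : finiteType m t k = finiteType m t' k := by
    have hf : (fun i => ForestOn t (Icc m k) k i) = fun i => ForestOn t' (Icc m k) k i :=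
      funext fun i => propext (forestOn_congr (fun j hj1 hj2 => h j hj1 (hj2.trans h2)) k i)
    rw [finiteType, finiteType, hf]
  rw [lift, lift, this, h k h1 h2]

theorem symbol_eq_iff {s : Fin 11} {p : Bool × Bool} {j : Fin 5} :
    symbol s = (p.1, p.2, j) ↔ letter s = p ∧ symbolType s = j := by
  simp only [letter, symbolType, Prod.ext_iff]
  tauto

/-- The forests on `[m, m + 2 + l]` of a given type, with symbols in prescribed sets. -/
def forests (m : ℤ) (C : ℤ → Set (Fin 11)) (l : ℕ) (j : Fin 5) : Set Config :=
  {t | SupportedOn m (m + 2 + l) t ∧ ForestOn t (Icc m (m + 2 + l)) (m + 2 + l) j ∧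
    lift m t ∈ box (m + 2) (m + 2 + l) C}

theorem finite_forests (m : ℤ) (C : ℤ → Set (Fin 11)) (l : ℕ) (j : Fin 5) :
    (forests m C l j).Finite :=
  (finite_supportedOn m (m + 2 + l)).subset fun _ h => h.1

/-- Appending the edges of `s` at the new vertex is a bijection; its inverse erases the edges
recorded there. Earlier symbols are unaffected, as each depends only on the configuration up to its
own place. -/
theorem ncard_fiber {m : ℤ} {C : ℤ → Set (Fin 11)} {l : ℕ} {i : Fin 5} {s : Fin 11}
    (hs : Legal i s) (hC : s ∈ C (m + 2 + l + 1)) :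
    {t | t ∈ forests m C (l + 1) (symbolType s) ∧ finiteType m t (m + 2 + l) = i ∧
      lift m t (m + 2 + l + 1) = s}.ncard = (forests m C l i).ncard := by
  set n : ℤ := m + 2 + l with hn
  have hn1 : m + 2 + (l + 1 : ℕ) = n + 1 := by push_cast; omega
  have hmn : m + 2 ≤ n := by omega
  symm
  refine Set.ncard_congr (fun t _ => Function.update t (n + 1) (letter s)) ?_ ?_ ?_
  · rintro t ⟨hsupp, hf, hb⟩
    rw [← hn] at hsupp hf hb
    set t' := Function.update t (n + 1) (letter s) with ht'
    have hne : ∀ k ≤ n, t' k = t k := fun k hk => Function.update_of_ne (by omega) _ _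
    have hself : t' (n + 1) = letter s := Function.update_self _ _ _
    have hf' : ForestOn t' (Icc m n) n i := (forestOn_congr (fun k _ hk => hne k hk) n i).2 hf
    have hf1 : ForestOn t' (Icc m (n + 1)) (n + 1) (symbolType s) :=
      (forestOn_Icc_succ hmn _).2 ⟨i, hf', by rw [hself]; exact hs⟩
    have hlift : lift m t' (n + 1) = s := by
      apply lift_eq
      rw [symbol_eq_iff, finiteType_eq hf1, hself]
      exact ⟨rfl, rfl⟩
    refine ⟨⟨?_, ?_, ?_⟩, finiteType_eq hf', hlift⟩
    · rw [hn1, supportedOn_iff]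
      intro k
      by_cases hk : k = n + 1
      · subst hk
        constructor <;> intro _ <;> omega
      · have h1 := supportedOn_iff.1 hsupp k
        rw [ht', Function.update_of_ne hk]
        exact ⟨fun h => ⟨(h1.1 h).1, (h1.1 h).2.trans (by omega)⟩,
          fun h => ⟨(h1.2 h).1, (h1.2 h).2.trans (by omega)⟩⟩
    · rw [hn1]; exact hf1
    · rw [hn1]
      intro k hk1 hk2
      rcases eq_or_lt_of_le hk2 with rfl | hk2
      · rw [hlift]; exact hC
      · rw [lift_congr (fun k _ hk => hne k hk) (by omega) (by omega)]
        exact hb k hk1 (by omega)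
  · rintro t t' ⟨hsupp, -⟩ ⟨hsupp', -⟩ h
    funext k
    by_cases hk : k = n + 1
    · subst hk
      rw [hsupp.eq_of_lt (by omega), hsupp'.eq_of_lt (by omega)]
    · have := congrFun h k
      simpa only [Function.update_of_ne hk] using this
  · rintro t' ⟨⟨hsupp, hf, hb⟩, hi, hl⟩
    rw [hn1] at hsupp hf hb
    set t := Function.update t' (n + 1) (false, false) with ht
    have hne : ∀ k ≤ n, t k = t' k := fun k hk => Function.update_of_ne (by omega) _ _
    obtain ⟨i', hi', hstep⟩ := (forestOn_Icc_succ hmn _).1 hf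
    obtain rfl : i' = i := by rw [← hi, finiteType_eq hi']
    obtain ⟨s', hs'⟩ := exists_symbol_of_step _ _ _ hstep
    have hss' : s' = s := by
      rw [← hl]
      symm
      apply lift_eq
      rw [hs', finiteType_eq hf]
    subst hss'
    have hlet : letter s' = t' (n + 1) := (symbol_eq_iff.1 hs').1
    refine ⟨t, ⟨?_, ?_, ?_⟩, ?_⟩
    · rw [← hn, supportedOn_iff]
      intro k
      by_cases hk : k = n + 1
      · subst hk
        rw [ht, Function.update_self]
        simp
      · have h1 := supportedOn_iff.1 hsupp k
        rw [ht, Function.update_of_ne hk]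
        exact ⟨fun h => ⟨(h1.1 h).1, by have := (h1.1 h).2; omega⟩,
          fun h => ⟨(h1.2 h).1, by have := (h1.2 h).2; omega⟩⟩
    · rw [← hn]
      exact (forestOn_congr (fun k _ hk => hne k hk) n _).2 hi'
    · intro k hk1 hk2
      rw [← hn] at hk2
      rw [lift_congr (fun k _ hk => hne k hk) (by omega) hk2]
      exact hb k hk1 (by omega)
    · rw [hlet, ht, Function.update_idem, Function.update_eq_self]

/-- Split by the type before the last vertex and by the last symbol: a fiber is empty unless the
transition is legal, ends in `j` and is allowed by `C`. -/
theorem ncard_forests_succ (m : ℤ) (C : ℤ → Set (Fin 11)) (l : ℕ) (j : Fin 5) :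
    ((forests m C (l + 1) j).ncard : ℝ) =
      ∑ i, ((forests m C l i).ncard : ℝ) * typeCount (C (m + 2 + l + 1)) i j := by
  classical
  have hfin := finite_forests m C (l + 1) j
  have h1 : (forests m C (l + 1) j).ncard = ∑ p : Fin 5 × Fin 11,
      {t | t ∈ forests m C (l + 1) j ∧ finiteType m t (m + 2 + l) = p.1 ∧
        lift m t (m + 2 + l + 1) = p.2}.ncard := by
    rw [ncard_eq_toFinset_card _ hfin, Finset.card_eq_sum_card_fiberwise
      (f := fun t => (finiteType m t (m + 2 + l), lift m t (m + 2 + l + 1)))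
      (t := Finset.univ) (fun _ _ => Finset.mem_univ _)]
    refine Finset.sum_congr rfl fun p _ => ?_
    rw [← ncard_coe_finset]
    congr 1
    ext t
    simp [Prod.ext_iff]
  have hn1 : m + 2 + (l + 1 : ℕ) = m + 2 + l + 1 := by push_cast; ring
  have h2 : ∀ i s, ({t | t ∈ forests m C (l + 1) j ∧ finiteType m t (m + 2 + l) = i ∧
        lift m t (m + 2 + l + 1) = s}.ncard : ℝ) = ((forests m C l i).ncard : ℝ) *
        if Legal i s ∧ symbolType s = j then (C (m + 2 + l + 1)).indicator 1 s else 0 := by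
    intro i s
    by_cases h : (Legal i s ∧ symbolType s = j) ∧ s ∈ C (m + 2 + l + 1)
    · obtain ⟨⟨hs, rfl⟩, hC⟩ := h
      rw [ncard_fiber hs hC]
      simp [hs, hC]
    · have : (if Legal i s ∧ symbolType s = j then (C (m + 2 + l + 1)).indicator 1 s else 0 : ℝ) =
          0 := by
        by_cases h' : Legal i s ∧ symbolType s = j
        · have hC : s ∉ C (m + 2 + l + 1) := fun hC => h ⟨h', hC⟩
          simp [h', hC]
        · rw [if_neg h']
      rw [this, mul_zero, Nat.cast_eq_zero]
      convert ncard_empty Config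
      rw [eq_empty_iff_forall_notMem]
      rintro t ⟨⟨-, hf, hb⟩, rfl, rfl⟩
      rw [hn1] at hf hb
      obtain ⟨i, hi, hstep⟩ := (forestOn_Icc_succ (by omega) _).1 hf
      obtain ⟨s, hs⟩ := exists_symbol_of_step _ _ _ hstep
      have hl : lift m t (m + 2 + l + 1) = s := lift_eq (by rw [hs, finiteType_eq hf])
      obtain ⟨h3, h4⟩ := symbol_eq_iff.1 hs
      refine h ⟨?_, hb _ (by omega) le_rfl⟩
      rw [hl, finiteType_eq hi]
      exact ⟨by rw [Legal, h3, h4]; exact hstep, h4⟩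
  rw [h1, Nat.cast_sum, Fintype.sum_prod_type]
  refine Finset.sum_congr rfl fun i _ => ?_
  simp only [h2, ← Finset.mul_sum]
  rfl

/-- The numbers of the forests of the five types on three vertices. -/
noncomputable def initialCount (i : Fin 5) : ℝ :=
  ({p : Bool × Bool | i = initialType p.1 p.2}.ncard : ℝ)

/-- The first three vertices carry no symbol, so `C` imposes nothing and the two short edges are
free. -/
theorem ncard_forests_zero (m : ℤ) (C : ℤ → Set (Fin 11)) (i : Fin 5) :
    ((forests m C 0 i).ncard : ℝ) = initialCount i := by
  rw [initialCount, Nat.cast_inj]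
  have h0 : m + 2 + ((0 : ℕ) : ℤ) = m + 2 := by simp
  refine Set.ncard_congr (fun t _ => ((t (m + 1)).2, (t (m + 2)).2)) ?_ ?_ ?_
  · rintro t ⟨-, hf, -⟩
    rw [h0] at hf
    exact (forestOn_three i).1 hf
  · rintro t t' ⟨hs, -⟩ ⟨hs', -⟩ h
    rw [h0] at hs hs'
    funext k
    rcases le_or_gt k m with hk | hk
    · rw [hs.eq_of_le hk, hs'.eq_of_le hk]
    rcases lt_or_ge (m + 2) k with hk2 | hk2
    · rw [hs.eq_of_lt hk2, hs'.eq_of_lt hk2]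
    have h1 := (supportedOn_iff.1 hs k).1
    have h1' := (supportedOn_iff.1 hs' k).1
    have e1 : (t k).1 = false := by
      by_contra hh; rw [Bool.not_eq_false] at hh; have := h1 hh; omega
    have e2 : (t' k).1 = false := by
      by_contra hh; rw [Bool.not_eq_false] at hh; have := h1' hh; omega
    refine Prod.ext (e1.trans e2.symm) ?_
    have : k = m + 1 ∨ k = m + 2 := by omega
    simp only [Prod.mk.injEq] at h
    rcases this with rfl | rfl
    · exact h.1
    · exact h.2
  · rintro ⟨x, y⟩ hxy
    let t : Config := fun k =>
      (false, if k = m + 1 then x else if k = m + 2 then y else false)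
    have e1 : (t (m + 1)).2 = x := if_pos rfl
    have e2 : (t (m + 2)).2 = y := by
      change (if m + 2 = m + 1 then x else if m + 2 = m + 2 then y else false) = y
      simp
    refine ⟨t, ⟨?_, ?_, ?_⟩, by rw [e1, e2]⟩
    · rw [h0, supportedOn_iff]
      intro k
      refine ⟨fun h => by simp [t] at h, fun h => ?_⟩
      by_cases hk1 : k = m + 1
      · omega
      by_cases hk2 : k = m + 2
      · omega
      simp [t, hk1, hk2] at h
    · rw [h0, forestOn_three, e1, e2]
      exact hxy
    · intro k h1 h2
      omega

theorem initialCount_dotProduct_pos : 0 < dotProduct initialCount rv := by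
  refine Finset.sum_pos' (fun i _ => mul_nonneg (Nat.cast_nonneg _) (rv_pos i).le)
    ⟨0, Finset.mem_univ _, mul_pos (Nat.cast_pos.2 ?_) (rv_pos 0)⟩
  rw [ncard_pos (toFinite _)]
  exact ⟨(true, true), rfl⟩

theorem ncard_forests (m : ℤ) (C : ℤ → Set (Fin 11)) (l : ℕ) (j : Fin 5) :
    ((forests m C l j).ncard : ℝ) =
      lam ^ l * Matrix.vecMul initialCount (boxMat (m + 2) C l) j := by
  induction l generalizing j with
  | zero => rw [ncard_forests_zero, boxMat, Matrix.vecMul_one, pow_zero, one_mul]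
  | succ l ih =>
    rw [ncard_forests_succ, boxMat, ← Matrix.vecMul_vecMul]
    simp only [ih]
    rw [Matrix.vecMul, dotProduct, Finset.mul_sum]
    refine Finset.sum_congr rfl fun i _ => ?_
    rw [normCount, Matrix.smul_apply, smul_eq_mul]
    have := lam_pos.ne'
    field_simp
    ring


/-! ### Convergence of the finite-volume measures -/

theorem ForestOn.restrict {t : Config} {m n : ℤ} {j : Fin 5} (h : ForestOn t (Icc m n) n j)
    {k : ℤ} (h1 : m + 2 ≤ k) (h2 : k ≤ n) : ∃ i, ForestOn t (Icc m k) k i := by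
  induction n, h2 using Int.leInduction generalizing j with
  | base => exact ⟨j, h⟩
  | succ n hn ih =>
    obtain ⟨i, hi, -⟩ := (forestOn_Icc_succ (by omega) j).1 h
    exact ih hi

theorem letter_lift {t : Config} {m n : ℤ} {j : Fin 5} (h : ForestOn t (Icc m n) n j)
    {k : ℤ} (h1 : m + 2 < k) (h2 : k ≤ n) : letter (lift m t k) = t k := by
  obtain ⟨i, hi⟩ := h.restrict h1.le h2
  obtain ⟨k, rfl⟩ : ∃ k', k = k' + 1 := ⟨k - 1, by ring⟩
  obtain ⟨i', -, hstep⟩ := (forestOn_Icc_succ (by omega) i).1 hi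
  obtain ⟨s, hs⟩ := exists_symbol_of_step _ _ _ hstep
  rw [lift_eq (s := s) (by rw [hs, finiteType_eq hi])]
  exact (symbol_eq_iff.1 hs).1

/-- The spanning trees of the piece `[-n, n]` whose symbols lie in a box. -/
def treesInBox (n : ℕ) (a : ℤ) (l : ℕ) (C : ℤ → Set (Fin 11)) : Set Config :=
  {t | t ∈ finiteSpanningTrees (-n) n ∧ lift (-n) t ∈ box a (a + l) C}

/-- The window `(a, a + l]` is padded by `k₁` free places on the left, counted after the initial
three vertices, and by `k₂` free places on the right. The final index `0` expresses that the whole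
piece is connected. -/
theorem ncard_treesInBox {n : ℕ} {a : ℤ} {l : ℕ} (C : ℤ → Set (Fin 11)) {k₁ k₂ : ℕ}
    (h1 : -(n : ℤ) + 2 + k₁ = a) (h2 : a + l + k₂ = n) :
    ((treesInBox n a l C).ncard : ℝ) = lam ^ (k₁ + l + k₂) * Matrix.vecMul initialCount
      (normCount univ ^ k₁ * boxMat a C l * normCount univ ^ k₂) 0 := by
  classical
  set D : ℤ → Set (Fin 11) := fun k => if a < k ∧ k ≤ a + l then C k else univ with hD
  have hn : -(n : ℤ) + 2 + (k₁ + l + k₂ : ℕ) = n := by push_cast; omega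
  have hset : treesInBox n a l C = forests (-n) D (k₁ + l + k₂) 0 := by
    ext t
    simp only [treesInBox, forests, Set.mem_ofPred_eq, hn]
    rw [mem_finiteSpanningTrees_iff (by omega), and_assoc]
    refine and_congr_right fun _ => and_congr_right fun _ => ?_
    constructor
    · intro h k hk1 hk2
      simp only [hD]
      split_ifs with hk
      · exact h k hk.1 hk.2
      · trivial
    · intro h k hk1 hk2
      have := h k (by omega) (by omega)
      simp only [hD] at this
      rwa [if_pos ⟨hk1, hk2⟩] at this
  have hD1 : boxMat (-(n : ℤ) + 2) D k₁ = normCount univ ^ k₁ := by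
    rw [← boxMat_univ (-(n : ℤ) + 2)]
    refine boxMat_congr fun k hk1 hk2 => if_neg ?_
    omega
  have hD2 : boxMat a D l = boxMat a C l :=
    boxMat_congr fun k hk1 hk2 => if_pos ⟨hk1, hk2⟩
  have hD3 : boxMat (a + l) D k₂ = normCount univ ^ k₂ := by
    rw [← boxMat_univ (a + l)]
    refine boxMat_congr fun k hk1 hk2 => if_neg ?_
    omega
  have e2 : -(n : ℤ) + 2 + (k₁ + l : ℕ) = a + l := by push_cast; omega
  rw [hset, ncard_forests, boxMat_add, boxMat_add, hD1, h1, hD2, e2, hD3]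

theorem boxProb_univ (a : ℤ) (l : ℕ) : boxProb a l (fun _ => univ) = 1 := by
  rw [boxProb, boxMat_univ]
  have : ∀ k : ℕ, (normCount univ ^ k).mulVec rv = rv := by
    intro k
    induction k with
    | zero => simp
    | succ k ih => rw [pow_succ, ← Matrix.mulVec_mulVec, normCount_univ_mulVec_rv, ih]
  rw [this, lv_dotProduct_rv]

/-- Numerator and denominator are sandwiches with the same paddings; the powers of `lam` and the end
factors cancel. -/
theorem tendsto_ncard_treesInBox (a : ℤ) (l : ℕ) (C : ℤ → Set (Fin 11)) :
    Filter.Tendsto (fun n : ℕ => ((treesInBox n a l C).ncard : ℝ) /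
      (finiteSpanningTrees (-n) n).ncard) Filter.atTop (nhds (boxProb a l C)) := by
  let k₁ : ℕ → ℕ := fun n => (a + n - 2).toNat
  let k₂ : ℕ → ℕ := fun n => (n - (a + l)).toNat
  have hk₁ : Filter.Tendsto k₁ Filter.atTop Filter.atTop :=
    Filter.tendsto_atTop.2 fun b => by
      filter_upwards [Filter.eventually_ge_atTop (b + a.natAbs + 2)] with n hn
      simp only [k₁]
      omega
  have hk₂ : Filter.Tendsto k₂ Filter.atTop Filter.atTop :=
    Filter.tendsto_atTop.2 fun b => by
      filter_upwards [Filter.eventually_ge_atTop (b + (a + l).natAbs)] with n hn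
      simp only [k₂]
      omega
  have hs := fun D => tendsto_sandwich initialCount (boxMat a D l) hk₁ hk₂ 0
  have hne : initialCount ⬝ᵥ rv * 1 * lv 0 ≠ 0 := by
    rw [mul_one]
    exact (mul_pos initialCount_dotProduct_pos (lv_pos 0)).ne'
  have h1 := hs fun _ => univ
  have e1 : lv ⬝ᵥ ((boxMat a (fun _ => univ) l).mulVec rv) = 1 := boxProb_univ a l
  rw [e1] at h1
  have h2 := (hs C).div h1 hne
  have e2 : initialCount ⬝ᵥ rv * lv ⬝ᵥ ((boxMat a C l).mulVec rv) * lv 0 /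
      (initialCount ⬝ᵥ rv * 1 * lv 0) = boxProb a l C := by
    have := initialCount_dotProduct_pos.ne'
    have := (lv_pos 0).ne'
    rw [boxProb]
    field_simp
  rw [e2] at h2
  refine h2.congr' ?_
  filter_upwards [Filter.eventually_ge_atTop (a.natAbs + l + 2)] with n hn
  have hn1 : -(n : ℤ) + 2 + k₁ n = a := by simp only [k₁]; omega
  have hn2 : a + l + k₂ n = n := by simp only [k₂]; omega
  have e3 : finiteSpanningTrees (-n) n = treesInBox n a l (fun _ => univ) := by
    ext t
    simp [treesInBox, box]
  rw [e3, ncard_treesInBox C hn1 hn2, ncard_treesInBox _ hn1 hn2,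
    mul_div_mul_left _ _ (pow_pos lam_pos _).ne']
  rfl

theorem finiteUST_real (n : ℕ) {A : Set Config} :
    (finiteUST n : Measure Config).real A =
      ({t | t ∈ finiteSpanningTrees (-n) n ∧ t ∈ A}.ncard : ℝ) /
        (finiteSpanningTrees (-n) n).ncard := by
  classical
  have hfin := finiteSpanningTrees_finite (-n) n
  have h1 : (finiteUST n : Measure Config) A =
      ProbabilityTheory.uniformOn (hfin.toFinset : Set Config)
        ((hfin.toFinset.filter fun t => t ∈ A : Finset Config) : Set Config) := by
    change ProbabilityTheory.uniformOn (finiteSpanningTrees (-n) n) A = _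
    rw [hfin.coe_toFinset, ← ProbabilityTheory.uniformOn_inter_self hfin]
    congr 1
    ext t
    simp
  have h2 : {t | t ∈ finiteSpanningTrees (-n) n ∧ t ∈ A} =
      (hfin.toFinset.filter fun t => t ∈ A : Finset Config) := by
    ext t; simp
  rw [Measure.real, h1, ProbabilityTheory.uniformOn_apply_finset, ENNReal.toReal_div,
    ENNReal.toReal_natCast, ENNReal.toReal_natCast, h2, ncard_coe_finset,
    ncard_eq_toFinset_card _ hfin, Finset.inter_eq_right.2 (Finset.filter_subset _ _)]

/-- Once the window lies inside the piece, the letters of the lifted symbols are the edges of the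
tree, so a condition on edges is a condition on symbols. -/
theorem tendsto_finiteUST_box (a : ℤ) (l : ℕ) (C : ℤ → Set (Bool × Bool)) :
    Filter.Tendsto (fun n => (finiteUST n : Measure Config).real (box a (a + l) C))
      Filter.atTop (nhds (boxProb a l fun k => letter ⁻¹' C k)) := by
  refine (tendsto_ncard_treesInBox a l _).congr' ?_
  filter_upwards [Filter.eventually_ge_atTop (a.natAbs + l + 2)] with n hn
  rw [finiteUST_real]
  congr 3
  ext t
  simp only [treesInBox, Set.mem_ofPred_eq]
  refine and_congr_right fun ht => ?_
  rw [mem_finiteSpanningTrees_iff (by omega)] at ht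
  refine forall_congr' fun k => forall_congr' fun h1 => forall_congr' fun h2 => ?_
  rw [mem_preimage, letter_lift ht.2 (by omega) (by omega)]

open Classical in
/-- The law of the sequence of symbols of a uniform spanning tree of `[-n, n]`. -/
noncomputable def liftedUST (n : ℕ) : ProbabilityMeasure (ℤ → Fin 11) :=
  -- As the image of a `PMF`, the law requires no measurability of `lift (-n)`.
  ⟨((PMF.uniformOfFinset (finiteSpanningTrees_finite (-n) n).toFinset
    ((finiteSpanningTrees_finite (-n) n).toFinset_nonempty.2
      (finiteSpanningTrees_nonempty _ _ (by omega)))).map (lift (-n))).toMeasure, inferInstance⟩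

theorem liftedUST_real_box (n : ℕ) (a : ℤ) (l : ℕ) (C : ℤ → Set (Fin 11)) :
    (liftedUST n : Measure (ℤ → Fin 11)).real (box a (a + l) C) =
      ((treesInBox n a l C).ncard : ℝ) / (finiteSpanningTrees (-n) n).ncard := by
  classical
  have hfin := finiteSpanningTrees_finite (-n) n
  have h2 : treesInBox n a l C =
      (hfin.toFinset.filter fun t => t ∈ lift (-n) ⁻¹' box a (a + l) C : Finset Config) := by
    ext t; simp [treesInBox]
  change (PMF.toMeasure _ _).toReal = _
  rw [PMF.toMeasure_apply_eq_toOuterMeasure_apply _ (measurableSet_box _ _ _),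
    PMF.toOuterMeasure_map_apply, PMF.toOuterMeasure_uniformOfFinset_apply, ENNReal.toReal_div,
    ENNReal.toReal_natCast, ENNReal.toReal_natCast, h2, ncard_coe_finset,
    ncard_eq_toFinset_card _ hfin]

/-- The law of the sequence of symbols. -/
theorem exists_symbolMeasure : ∃ Q : ProbabilityMeasure (ℤ → Fin 11), ∀ a (l : ℕ) C,
    (Q : Measure (ℤ → Fin 11)).real (box a (a + l) C) = boxProb a l C := by
  obtain ⟨Q, -, hQ⟩ := exists_tendsto_of_tendsto_box (μ := liftedUST) (c := boxProb)
    fun a l C => by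
      simp only [liftedUST_real_box]
      exact tendsto_ncard_treesInBox a l C
  exact ⟨Q, hQ⟩

/-- The configuration of edges of a sequence of symbols. -/
def decode (ω : ℤ → Fin 11) : Config := fun k => letter (ω k)

theorem measurable_decode : Measurable decode :=
  measurable_pi_lambda _ fun k => (measurable_of_countable letter).comp (measurable_pi_apply k)

theorem isUST_map {Q : ProbabilityMeasure (ℤ → Fin 11)}
    (hQ : ∀ a (l : ℕ) C, (Q : Measure (ℤ → Fin 11)).real (box a (a + l) C) = boxProb a l C) :
    IsUST (Q.map measurable_decode.aemeasurable) := by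
  obtain ⟨P, hP, hP'⟩ := exists_tendsto_of_tendsto_box (μ := finiteUST)
    (c := fun a l C => boxProb a l fun k => letter ⁻¹' C k) tendsto_finiteUST_box
  suffices Q.map measurable_decode.aemeasurable = P by rw [this]; exact hP
  refine Subtype.ext (@ext_of_box _ _ _ _ (Subtype.prop _) P.2
    fun a l C => ?_)
  refine Eq.trans ?_ (hP' a l C).symm
  rw [← hQ]
  exact map_measureReal_apply measurable_decode (measurableSet_box _ _ _)


/-! ### The Markov property of the law of the symbols -/

theorem typeCount_singleton (s : Fin 11) (i j : Fin 5) :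
    typeCount {s} i j = if Legal i s ∧ symbolType s = j then 1 else 0 := by
  rw [typeCount, Finset.sum_eq_single s]
  · simp
  · intro k _ hk
    simp [hk]
  · simp

/-- The matrix of a single symbol has one nonzero column, that of its type. It separates past from
future, which is the source of the Markov property. -/
theorem vecMul_normCount_singleton (x : Fin 5 → ℝ) (s : Fin 11) (f : Fin 5 → ℝ) :
    dotProduct (Matrix.vecMul x (normCount {s})) f =
      (∑ i, if Legal i s then x i else 0) * f (symbolType s) * lam⁻¹ := by
  simp only [dotProduct, Matrix.vecMul, normCount, Matrix.smul_apply, typeCount_singleton,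
    smul_eq_mul]
  rw [Finset.sum_eq_single (symbolType s)]
  · rw [Finset.sum_mul, Finset.sum_mul, Finset.sum_mul]
    refine Finset.sum_congr rfl fun i _ => ?_
    by_cases h : Legal i s <;> simp [h]
    ring
  · intro j _ hj
    rw [Finset.sum_eq_zero fun i _ => by simp [Ne.symm hj], zero_mul]
  · simp

theorem boxProb_succ (a : ℤ) (l : ℕ) (C : ℤ → Set (Fin 11)) :
    boxProb a (l + 1) C = dotProduct (Matrix.vecMul (Matrix.vecMul lv (boxMat a C l))
      (normCount (C (a + l + 1)))) rv := by
  rw [boxProb, boxMat, Matrix.dotProduct_mulVec, Matrix.vecMul_vecMul]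

theorem boxProb_markov {a : ℤ} {l : ℕ} {C : ℤ → Set (Fin 11)} {s s' : Fin 11}
    (h : C (a + l + 1) = {s}) (h' : C (a + l + 2) = {s'}) :
    boxProb a (l + 2) C = boxProb a (l + 1) C * R s s' := by
  have e : a + ((l + 1 : ℕ) : ℤ) + 1 = a + l + 2 := by push_cast; ring
  rw [show l + 2 = l + 1 + 1 by rfl, boxProb_succ a (l + 1), boxProb_succ a l, e, h', h,
    vecMul_normCount_singleton, vecMul_normCount_singleton, R_apply, boxMat, h,
    ← Matrix.vecMul_vecMul]
  set y := Matrix.vecMul lv (boxMat a C l)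
  have h1 : (∑ i, if Legal i s' then Matrix.vecMul y (normCount {s}) i else 0) =
      dotProduct (Matrix.vecMul y (normCount {s})) fun i => if Legal i s' then 1 else 0 := by
    simp only [dotProduct, mul_ite, mul_one, mul_zero]
  rw [h1, vecMul_normCount_singleton]
  have := lam_pos.ne'
  have := (rv_pos (symbolType s)).ne'
  split_ifs
  · field_simp
  · simp

theorem boxProb_one (a : ℤ) (s : Fin 11) {C : ℤ → Set (Fin 11)} (h : C (a + 1) = {s}) :
    boxProb a 1 C = invDist s := by
  rw [boxProb_succ, Nat.cast_zero, add_zero, h, vecMul_normCount_singleton, boxMat,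
    Matrix.vecMul_one, invDist_eq, symbolLaw]

/-- `Q` is the law of the sequence of symbols. -/
def IsSymbolLaw (Q : Measure (ℤ → Fin 11)) : Prop :=
  ∀ a (l : ℕ) C, Q.real (box a (a + l) C) = boxProb a l C

section SymbolLaw

variable {Q : Measure (ℤ → Fin 11)}

theorem IsSymbolLaw.real_eq (hQ : IsSymbolLaw Q) (n : ℤ) (s : Fin 11) :
    Q.real {ω | ω n = s} = invDist s := by
  have : {ω : ℤ → Fin 11 | ω n = s} = box (n - 1) (n - 1 + (1 : ℕ)) fun _ => {s} := by
    ext ω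
    simp only [box, Set.mem_ofPred_eq, mem_singleton_iff]
    constructor
    · rintro h k h1 h2
      rw [show k = n by push_cast at h2; omega, h]
    · intro h
      exact h n (by omega) (by push_cast; omega)
  rw [this, hQ, boxProb_one (n - 1) s rfl]

theorem IsSymbolLaw.markov (hQ : IsSymbolLaw Q) (n : ℤ) (k : ℕ) (s : ℕ → Fin 11) (j : Fin 11) :
    Q.real {ω | ω (n + 1) = j ∧ ∀ i : ℕ, i ≤ k → ω (n - i) = s i} =
      Q.real {ω | ∀ i : ℕ, i ≤ k → ω (n - i) = s i} * R (s 0) j := by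
  -- The sequence `s` lists the past backwards from `n`, while boxes run forwards.
  let C : ℤ → Set (Fin 11) := fun m => if m = n + 1 then {j} else {s (n - m).toNat}
  have hC : ∀ m ≤ n, C m = {s (n - m).toNat} := fun m hm => if_neg (by omega)
  have hC1 : C (n + 1) = {j} := if_pos rfl
  have h2 : {ω : ℤ → Fin 11 | ∀ i : ℕ, i ≤ k → ω (n - i) = s i} =
      box (n - k - 1) (n - k - 1 + (k + 1 : ℕ)) C := by
    ext ω
    simp only [box, Set.mem_ofPred_eq]
    constructor
    · intro h m h3 h4
      push_cast at h4
      rw [hC m (by omega), mem_singleton_iff, ← h (n - m).toNat (by omega)]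
      congr 1
      omega
    · intro h i hi
      have := h (n - i) (by omega) (by push_cast; omega)
      rw [hC _ (by omega), mem_singleton_iff] at this
      rw [this]
      congr 1
      omega
  have h1 : {ω : ℤ → Fin 11 | ω (n + 1) = j ∧ ∀ i : ℕ, i ≤ k → ω (n - i) = s i} =
      box (n - k - 1) (n - k - 1 + (k + 2 : ℕ)) C := by
    ext ω
    have h3 : (∀ i : ℕ, i ≤ k → ω (n - i) = s i) ↔ ω ∈ box (n - k - 1) (n - k - 1 + (k + 1 : ℕ)) C := by
      rw [← h2]; rfl
    rw [Set.mem_ofPred_eq, h3]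
    constructor
    · rintro ⟨h4, h5⟩ m h6 h7
      by_cases hm : m = n + 1
      · rw [hm, hC1]; exact h4
      · exact h5 m h6 (by push_cast at h7 ⊢; omega)
    · intro h
      refine ⟨?_, fun m h6 h7 => h m h6 (by push_cast at h7 ⊢; omega)⟩
      have := h (n + 1) (by omega) (by push_cast; omega)
      rwa [hC1] at this
  rw [h1, h2, hQ, hQ]
  refine boxProb_markov ?_ ?_
  · rw [show n - k - 1 + (k : ℤ) + 1 = n by ring, hC n le_rfl]
    simp
  · rw [show n - k - 1 + (k : ℤ) + 2 = n + 1 by ring, hC1]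

variable [IsProbabilityMeasure Q]

theorem IsSymbolLaw.map_shift (hQ : IsSymbolLaw Q) (k : ℤ) :
    Q.map (fun ω (n : ℤ) => ω (n + k)) = Q := by
  have hm : Measurable fun (ω : ℤ → Fin 11) (n : ℤ) => ω (n + k) :=
    measurable_pi_lambda _ fun n => measurable_pi_apply (n + k)
  have := Measure.isProbabilityMeasure_map (μ := Q) hm.aemeasurable
  refine ext_of_box fun a l C => ?_
  rw [map_measureReal_apply hm (measurableSet_box _ _ _), hQ]
  have : (fun (ω : ℤ → Fin 11) (n : ℤ) => ω (n + k)) ⁻¹' box a (a + l) C =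
      box (a + k) (a + k + l) fun m => C (m - k) := by
    ext ω
    simp only [box, mem_preimage, Set.mem_ofPred_eq]
    constructor
    · intro h m h1 h2
      have := h (m - k) (by omega) (by omega)
      rwa [sub_add_cancel] at this
    · intro h m h1 h2
      have := h (m + k) (by omega) (by omega)
      rwa [add_sub_cancel_right] at this
  rw [this, hQ, boxProb, boxProb, boxMat_shift]
  simp only [add_sub_cancel_right]

theorem IsSymbolLaw.ae_legal (hQ : IsSymbolLaw Q) :
    ∀ᵐ ω ∂Q, ∀ n : ℤ, Legal (symbolType (ω n)) (ω (n + 1)) := by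
  rw [ae_all_iff]
  intro n
  have : ∀ s s' : Fin 11, ∀ᵐ ω ∂Q, ω n = s → ω (n + 1) = s' → Legal (symbolType s) s' := by
    intro s s'
    by_cases h : Legal (symbolType s) s'
    · exact Filter.Eventually.of_forall fun _ _ _ => h
    · have h0 := hQ.markov n 0 (fun _ => s) s'
      rw [R_apply, if_neg h, mul_zero, measureReal_eq_zero_iff] at h0
      refine measure_mono_null ?_ h0
      intro ω hω
      simp only [mem_compl_iff, Set.mem_ofPred_eq, Classical.not_imp] at hω
      refine ⟨hω.2.1, fun i hi => ?_⟩
      rw [Nat.le_zero.1 hi, Nat.cast_zero, sub_zero, hω.1]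
  filter_upwards [ae_all_iff.2 fun s => ae_all_iff.2 (this s)] with ω hω
  exact hω _ _ rfl rfl

/-! ### Recurrence of the pattern `δ₁ δ₁` -/

theorem normCount_zero_mulVec (f : Fin 5 → ℝ) :
    (normCount {0}).mulVec f = fun i => if i = 0 then lam⁻¹ * f 0 else 0 := by
  have hL : ∀ i, (Legal i 0 ∧ True) ↔ i = 0 := by decide
  ext i
  simp only [Matrix.mulVec, dotProduct, normCount, Matrix.smul_apply, typeCount_singleton,
    smul_eq_mul]
  rw [Finset.sum_eq_single 0]
  · have : symbolType 0 = 0 := rfl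
    simp only [this, hL]
    split_ifs <;> simp
  · intro j _ hj
    have : ¬ symbolType 0 = j := fun h => hj (h ▸ rfl)
    simp [this]
  · simp

/-- From every type, two free steps can reach type 1, and there `δ₁` may be appended twice. Measured
against `rv`, this bounds below the conditional probability of the pattern in a block of four,
uniformly in the past. -/
theorem exists_renewal_constant : ∃ c : ℝ, 0 < c ∧ c < 1 ∧ ∀ i, c * rv i ≤
    (normCount univ * normCount univ * normCount {0} * normCount {0}).mulVec rv i := by
  set g := (normCount univ * normCount univ * normCount {0} * normCount {0}).mulVec rv with hg
  have hpos : ∀ i, 0 < g i := by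
    intro i
    have h1 : g i = (normCount univ * normCount univ) i 0 * (lam⁻¹ * (lam⁻¹ * rv 0)) := by
      rw [hg, ← Matrix.mulVec_mulVec, ← Matrix.mulVec_mulVec, normCount_zero_mulVec,
        normCount_zero_mulVec]
      simp [Matrix.mulVec, dotProduct]
    rw [h1]
    have hl := inv_pos.2 lam_pos
    refine mul_pos ?_ (mul_pos hl (mul_pos hl (rv_pos 0)))
    let N : Matrix (Fin 5) (Fin 5) ℕ :=
      !![2, 1, 0, 0, 0; 1, 0, 1, 1, 1; 1, 1, 0, 0, 0; 0, 0, 2, 0, 1; 0, 0, 1, 0, 1]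
    have hN : typeCount univ = N.map (Nat.castRingHom ℝ) := by
      rw [typeCount_univ]
      ext i j
      fin_cases i <;> fin_cases j <;> simp [N]
    have h : ∀ i, 0 < (N * N) i 0 := by decide
    rw [normCount, smul_mul_smul_comm, Matrix.smul_apply, smul_eq_mul, hN, ← Matrix.map_mul,
      Matrix.map_apply]
    exact mul_pos (mul_pos hl hl) (by simpa using h i)
  obtain ⟨i, hi⟩ := Finite.exists_min fun i => g i / rv i
  refine ⟨min (g i / rv i) (1 / 2), lt_min (div_pos (hpos i) (rv_pos i)) (by norm_num),
    (min_le_right _ _).trans_lt (by norm_num), fun j => ?_⟩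
  rw [← le_div_iff₀ (rv_pos j)]
  exact (min_le_left _ _).trans (hi j)

theorem boxMat_nonneg (a : ℤ) (C : ℤ → Set (Fin 11)) (l : ℕ) (i j : Fin 5) :
    0 ≤ boxMat a C l i j := by
  induction l generalizing j with
  | zero => rw [boxMat, Matrix.one_apply]; split_ifs <;> norm_num
  | succ l ih =>
    rw [boxMat, Matrix.mul_apply]
    exact Finset.sum_nonneg fun k _ => mul_nonneg (ih k) (normCount_nonneg _ _ _)

/-- The sequences without the pattern `δ₁ δ₁` at the ends of `m` consecutive blocks of length
four. -/
def noRenewal (a : ℤ) (m : ℕ) : Set (ℤ → Fin 11) :=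
  {ω | ∀ b : ℕ, b < m → ¬ (ω (a + 4 * b + 3) = 0 ∧ ω (a + 4 * b + 4) = 0)}

theorem IsSymbolLaw.exists_noRenewal_le (hQ : IsSymbolLaw Q) : ∃ r : ℝ, 0 ≤ r ∧ r < 1 ∧
    ∀ (a : ℤ) (m : ℕ), Q.real (noRenewal a m) ≤ r ^ m := by
  obtain ⟨c, hc0, hc1, hc⟩ := exists_renewal_constant
  refine ⟨1 - c, by linarith, by linarith, ?_⟩
  -- The bound is proved relative to an arbitrary box in the past, so that after one block the
  -- induction applies to a longer box.
  suffices H : ∀ (a : ℤ) (m l : ℕ) (C : ℤ → Set (Fin 11)),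
      Q.real (box a (a + l) C ∩ noRenewal (a + l) m) ≤ (1 - c) ^ m * Q.real (box a (a + l) C) by
    intro a m
    have h := H a m 0 fun _ => univ
    have hu : box a (a + (0 : ℕ)) (fun _ => (univ : Set (Fin 11))) = univ := by ext; simp [box]
    rw [hu, univ_inter, Nat.cast_zero, add_zero, probReal_univ, mul_one] at h
    exact h
  intro a m
  induction m with
  | zero => intro l C; rw [pow_zero, one_mul]; exact measureReal_mono inter_subset_left
  | succ m ih =>
    intro l C
    let D : Set (Fin 11) → Set (Fin 11) → ℤ → Set (Fin 11) := fun E E' k =>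
      if k ≤ a + l then C k else if k = a + l + 3 then E else if k = a + l + 4 then E' else univ
    have hbox : ∀ E E', box a (a + (l + 4 : ℕ)) (D E E') =
        box a (a + l) C ∩ {ω | ω (a + l + 3) ∈ E ∧ ω (a + l + 4) ∈ E'} := by
      intro E E'
      ext ω
      simp only [box, mem_inter_iff, Set.mem_ofPred_eq, D]
      push_cast
      constructor
      · intro h
        refine ⟨fun k h1 h2 => ?_, ?_, ?_⟩
        · have := h k h1 (by omega)
          rwa [if_pos h2] at this
        · have := h (a + l + 3) (by omega) (by omega)
          rwa [if_neg (by omega), if_pos rfl] at this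
        · have := h (a + l + 4) (by omega) (by omega)
          rwa [if_neg (by omega), if_neg (by omega), if_pos rfl] at this
      · rintro ⟨h1, h2, h3⟩ k h4 h5
        split_ifs with h6 h7 h8
        · exact h1 k h4 h6
        · rw [h7]; exact h2
        · rw [h8]; exact h3
        · trivial
    have hD0 : boxMat a (D {0} {0}) (l + 4) = boxMat a C l *
        (normCount univ * normCount univ * normCount {0} * normCount {0}) := by
      have e1 : D {0} {0} (a + l + 1) = univ := by
        simp only [D]; rw [if_neg (by omega), if_neg (by omega), if_neg (by omega)]
      have e2 : D {0} {0} (a + (l + 1 : ℕ) + 1) = univ := by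
        simp only [D]; push_cast; rw [if_neg (by omega), if_neg (by omega), if_neg (by omega)]
      have e3 : D {0} {0} (a + (l + 2 : ℕ) + 1) = {0} := by
        simp only [D]; push_cast; rw [if_neg (by omega), if_pos (by omega)]
      have e4 : D {0} {0} (a + (l + 3 : ℕ) + 1) = {0} := by
        simp only [D]; push_cast; rw [if_neg (by omega), if_neg (by omega), if_pos (by omega)]
      have e0 : boxMat a (D {0} {0}) l = boxMat a C l :=
        boxMat_congr fun k _ h2 => if_pos h2
      rw [show l + 4 = l + 3 + 1 by rfl, boxMat, boxMat, boxMat, boxMat, e0, e1, e2, e3, e4]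
      simp only [mul_assoc]
    have hlow : c * Q.real (box a (a + l) C) ≤
        Q.real (box a (a + (l + 4 : ℕ)) (D {0} {0})) := by
      rw [hQ, hQ, boxProb, boxProb, hD0, ← Matrix.mulVec_mulVec, Matrix.dotProduct_mulVec,
        Matrix.dotProduct_mulVec, dotProduct, dotProduct, Finset.mul_sum]
      refine Finset.sum_le_sum fun i _ => ?_
      rw [mul_left_comm]
      refine mul_le_mul_of_nonneg_left (hc i) ?_
      change 0 ≤ ∑ j, lv j * boxMat a C l j i
      exact Finset.sum_nonneg fun j _ => mul_nonneg (lv_pos j).le (boxMat_nonneg _ _ _ _ _)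
    have hmeas : ∀ E E', MeasurableSet (box a (a + (l + 4 : ℕ)) (D E E')) :=
      fun E E' => measurableSet_box _ _ _
    have hsum : Q.real (box a (a + (l + 4 : ℕ)) (D {0} {0})) +
        (Q.real (box a (a + (l + 4 : ℕ)) (D {0}ᶜ univ)) +
          Q.real (box a (a + (l + 4 : ℕ)) (D {0} {0}ᶜ))) ≤ Q.real (box a (a + l) C) := by
      rw [← measureReal_union ?_ (hmeas _ _), ← measureReal_union ?_ ((hmeas _ _).union (hmeas _ _))]
      · refine measureReal_mono ?_
        simp only [hbox]
        exact union_subset inter_subset_left (union_subset inter_subset_left inter_subset_left)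
      · simp only [hbox]
        rw [disjoint_left]
        rintro ω ⟨-, h1, h2⟩ (⟨-, h3, -⟩ | ⟨-, -, h4⟩)
        · exact h3 h1
        · exact h4 h2
      · simp only [hbox]
        rw [disjoint_left]
        rintro ω ⟨-, h1, -⟩ ⟨-, h3, -⟩
        exact h1 h3
    -- Failure of the pattern in the first block is split into two disjoint boxes: the first `δ₁` is
    -- missing, or only the second one is.
    have hsub : box a (a + l) C ∩ noRenewal (a + l) (m + 1) ⊆
        (box a (a + (l + 4 : ℕ)) (D {0}ᶜ univ) ∩ noRenewal (a + (l + 4 : ℕ)) m) ∪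
          (box a (a + (l + 4 : ℕ)) (D {0} {0}ᶜ) ∩ noRenewal (a + (l + 4 : ℕ)) m) := by
      rintro ω ⟨h1, h2⟩
      have h3 : ω ∈ noRenewal (a + (l + 4 : ℕ)) m := by
        intro b hb
        have := h2 (b + 1) (by omega)
        push_cast at this ⊢
        rwa [show a + l + 4 * (b + 1 : ℤ) + 3 = a + (l + 4) + 4 * b + 3 by ring,
          show a + l + 4 * (b + 1 : ℤ) + 4 = a + (l + 4) + 4 * b + 4 by ring] at this
      have h4 := h2 0 (by omega)
      rw [Nat.cast_zero, mul_zero, add_zero] at h4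
      rw [hbox, hbox]
      by_cases h5 : ω (a + l + 3) = 0
      · exact .inr ⟨⟨h1, h5, fun h6 => h4 ⟨h5, h6⟩⟩, h3⟩
      · exact .inl ⟨⟨h1, h5, trivial⟩, h3⟩
    refine (measureReal_mono hsub).trans ((measureReal_union_le _ _).trans ?_)
    refine (add_le_add (ih (l + 4) _) (ih (l + 4) _)).trans ?_
    rw [← mul_add, pow_succ, mul_assoc]
    exact mul_le_mul_of_nonneg_left (by linarith) (pow_nonneg (by linarith) _)

/-- Absence of the pattern on a half-line entails its absence from any number `m` of blocks, with
probability at most `r ^ m`. On the left the blocks start at `n - 4 * m`, so that the last one ends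
at `n`. -/
theorem IsSymbolLaw.ae_renewal (hQ : IsSymbolLaw Q) : ∀ᵐ ω ∂Q, ∀ n : ℤ,
    (∃ j ≤ n, ω (j - 1) = 0 ∧ ω j = 0) ∧ ∃ j ≥ n, ω (j - 1) = 0 ∧ ω j = 0 := by
  obtain ⟨r, hr0, hr1, hr⟩ := hQ.exists_noRenewal_le
  have hnull : ∀ (A : Set (ℤ → Fin 11)) (a : ℕ → ℤ), (∀ m, A ⊆ noRenewal (a m) m) → Q A = 0 := by
    intro A a h
    rw [← measureReal_eq_zero_iff]
    refine le_antisymm ?_ measureReal_nonneg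
    refine ge_of_tendsto' (tendsto_pow_atTop_nhds_zero_of_lt_one hr0 hr1) fun m => ?_
    exact (measureReal_mono (h m)).trans (hr _ m)
  rw [ae_all_iff]
  intro n
  rw [Filter.eventually_and]
  constructor
  · refine hnull _ (fun m => n - 4 * m) fun m ω hω b hb hb' => hω ⟨n - 4 * m + 4 * b + 4, ?_, ?_, ?_⟩
    · omega
    · rw [← hb'.1]; congr 1; ring
    · exact hb'.2
  · refine hnull _ (fun _ => n) fun m ω hω b hb hb' => hω ⟨n + 4 * b + 4, ?_, ?_, ?_⟩
    · omega
    · rw [← hb'.1]; congr 1; ring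
    · exact hb'.2

end SymbolLaw

/-! ### Decoding a sequence of symbols -/

/-- At an occurrence of `δ₁ δ₁` the vertices `j - 2, j - 1, j` form a path, so the forest started at
`j - 2` has at `j` the type that the symbol claims. Legality carries the agreement on to `n`, and
such starting points exist arbitrarily far to the left. -/
theorem forestOn_decode {ω : ℤ → Fin 11} (hL : ∀ n : ℤ, Legal (symbolType (ω n)) (ω (n + 1)))
    (hren : ∀ n : ℤ, ∃ j ≤ n, ω (j - 1) = 0 ∧ ω j = 0) (n : ℤ) :
    ForestOn (decode ω) (Iic n) n (symbolType (ω n)) := by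
  refine forestOn_Iic_of_frequently fun m₀ => ?_
  -- The shift by two makes the starting vertex `j - 2` at most `m₀`.
  obtain ⟨j, hj, h1, h2⟩ := hren (min (m₀ + 2) n)
  refine ⟨j - 2, by omega, ?_⟩
  have hjn : j ≤ n := by omega
  clear hj
  induction n, hjn using Int.leInduction with
  | base =>
    have := (forestOn_three (t := decode ω) (m := j - 2) 0).2 ?_
    · rw [sub_add_cancel] at this
      rw [h2]
      exact this
    · rw [show j - 2 + 1 = j - 1 by ring, sub_add_cancel, decode, decode, h1, h2]
      rfl
  | succ n hn ih => exact (forestOn_Icc_succ (by omega) _).2 ⟨_, ih, hL n⟩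

/-- Any two vertices lie to the left of some `j` with symbol `δ₁`; there the forest on `Iic j` has
type 1, hence a single component. A cycle would already lie in some `Iic k`. -/
theorem decode_mem_spanningTrees {ω : ℤ → Fin 11}
    (hf : ∀ n, ForestOn (decode ω) (Iic n) n (symbolType (ω n)))
    (hren : ∀ n : ℤ, ∃ j ≥ n, ω (j - 1) = 0 ∧ ω j = 0) : decode ω ∈ spanningTrees := by
  have hU : ⋃ k : ℕ, Iic (k : ℤ) = univ := by
    ext x
    simp only [mem_iUnion, mem_Iic, mem_univ, iff_true]
    exact ⟨x.toNat, by omega⟩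
  have hmono : Monotone fun k : ℕ => Iic (k : ℤ) := fun k l h => Iic_subset_Iic.2 (by omega)
  have : Nonempty ℤ := ⟨0⟩
  refine ⟨⟨fun a b => ?_⟩, ?_⟩
  · obtain ⟨j, hj, -, h0⟩ := hren (max a b)
    have h := hf j
    rw [h0] at h
    obtain ⟨-, hc, h1, h2⟩ := h
    have key : ∀ v ≤ j, ReachIn (graph (decode ω)) (Iic j) v j := by
      intro v hv
      rcases hc v hv with h | h | h
      · exact h
      · exact h.trans h1.symm
      · exact (h.trans h2.symm).trans h1.symm
    rw [← reachIn_univ]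
    exact ((key a (by omega)).trans (key b (by omega)).symm).mono (fun _ _ _ _ h => h)
      (subset_univ _)
  · rw [isAcyclic_iff_acyclicIn_univ, ← hU, acyclicIn_iUnion hmono]
    exact fun k => (hf k).1

theorem Y_decode {ω : ℤ → Fin 11}
    (hf : ∀ n, ForestOn (decode ω) (Iic n) n (symbolType (ω n))) (n : ℤ) :
    Y n (decode ω) = ω n := by
  apply Y_eq
  rw [code, forestType_eq (hf n)]
  exact symbol_eq_iff.2 ⟨rfl, rfl⟩

theorem measurableSet_spanningTrees : MeasurableSet spanningTrees := by
  have hU : ⋃ k : ℕ, Iic (k : ℤ) = univ := by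
    ext x
    simp only [mem_iUnion, mem_Iic, mem_univ, iff_true]
    exact ⟨x.toNat, by omega⟩
  have hmono : Monotone fun k : ℕ => Iic (k : ℤ) := fun k l h => Iic_subset_Iic.2 (by omega)
  have : spanningTrees = (⋂ a : ℤ, ⋂ b : ℤ, ⋃ k : ℕ, {t | ReachIn (graph t) (Iic (k : ℤ)) a b}) ∩
      ⋂ k : ℕ, {t | AcyclicIn (graph t) (Iic (k : ℤ))} := by
    ext t
    simp only [mem_inter_iff, mem_iInter, mem_iUnion, Set.mem_ofPred_eq, ← reachIn_iUnion hmono,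
      ← acyclicIn_iUnion hmono, hU, reachIn_univ, ← isAcyclic_iff_acyclicIn_univ]
    have : Nonempty ℤ := ⟨0⟩
    exact ⟨fun h => ⟨h.connected.preconnected, h.isAcyclic⟩, fun h => ⟨⟨h.1⟩, h.2⟩⟩
  rw [this]
  exact (MeasurableSet.iInter fun a => MeasurableSet.iInter fun b => MeasurableSet.iUnion fun k =>
    measurableSet_reachIn _ _ _).inter (MeasurableSet.iInter fun k => measurableSet_acyclicIn _)

end HelixUST

/-! ### Transfer from symbol sequences to spanning trees -/

theorem theorem5 :
    ∃ P : MeasureTheory.ProbabilityMeasure HelixUST.Config,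
      -- `P` is the uniform spanning tree measure, the weak limit of the finite-volume measures
      HelixUST.IsUST P ∧
      -- it is concentrated on the spanning trees
      (∀ᵐ t ∂(P : MeasureTheory.Measure HelixUST.Config), t ∈ HelixUST.spanningTrees) ∧
      -- for a spanning tree `t` and every `n`, the restriction to `{n, n - 1, …}` has exactly one
      -- type, and the code `φ_n(t)` is one of the 11 symbols, namely the one with index `Y n t`
      (∀ t ∈ HelixUST.spanningTrees, ∀ n : ℤ,
        (∃! i : Fin 5, t ∈ HelixUST.Gamma n i) ∧
          HelixUST.symbol (HelixUST.Y n t) = HelixUST.code n t) ∧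
      -- `Y` is a stationary Markov chain with transition matrix `R`
      HelixUST.IsStationaryMarkovChain (P : MeasureTheory.Measure HelixUST.Config)
        HelixUST.Y HelixUST.R ∧
      -- `invDist` is the law of each `Y n` and the only invariant distribution of `R`
      (∀ (n : ℤ) (k : Fin 11),
        (P : MeasureTheory.Measure HelixUST.Config).real {t | HelixUST.Y n t = k} =
          HelixUST.invDist k) ∧
      (∀ ν ∈ stdSimplex ℝ (Fin 11),
        Matrix.vecMul ν HelixUST.R = ν ↔ ν = HelixUST.invDist) ∧
      -- the entropy of the chain
      HelixUST.chainEntropy HelixUST.invDist HelixUST.R =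
        Real.log (HelixUST.γ + √HelixUST.γ) := by
  open HelixUST in
  obtain ⟨Q, hQ⟩ := exists_symbolMeasure
  have hlaw : IsSymbolLaw (Q : Measure (ℤ → Fin 11)) := hQ
  have hgood : ∀ᵐ ω ∂(Q : Measure (ℤ → Fin 11)), decode ω ∈ spanningTrees ∧
      (fun n => Y n (decode ω)) = ω := by
    filter_upwards [hlaw.ae_legal, hlaw.ae_renewal] with ω hL hren
    have hf := forestOn_decode hL fun n => (hren n).1
    exact ⟨decode_mem_spanningTrees hf fun n => (hren n).2, funext fun n => Y_decode hf n⟩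
  have hY : Measurable fun (t : Config) (n : ℤ) => Y n t := measurable_pi_lambda _ measurable_Y
  -- `Y` inverts `decode` almost surely, so under the tree measure the process `Y` has the law `Q`,
  -- and every statement about `Y` becomes one about the coordinates under `Q`.
  have hmap : ((Q : Measure (ℤ → Fin 11)).map decode).map (fun t (n : ℤ) => Y n t) = Q := by
    rw [Measure.map_map hY measurable_decode]
    refine (Measure.map_congr (hgood.mono fun ω h => h.2)).trans ?_
    exact Measure.map_id
  have hP : ((Q.map measurable_decode.aemeasurable : ProbabilityMeasure Config) : Measure Config) =
      (Q : Measure (ℤ → Fin 11)).map decode := rfl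
  have hreal : ∀ E : Set (ℤ → Fin 11), MeasurableSet E →
      ((Q : Measure (ℤ → Fin 11)).map decode).real {t | (fun n => Y n t) ∈ E} =
        (Q : Measure (ℤ → Fin 11)).real E := by
    intro E hE
    rw [← hmap, map_measureReal_apply hY hE, hmap]
    rfl
  have hcoord : ∀ (n : ℤ) (s : Fin 11), MeasurableSet {ω : ℤ → Fin 11 | ω n = s} :=
    fun n s => measurableSet_eq_fun (measurable_pi_apply n) measurable_const
  have hcyl : ∀ (n : ℤ) (k : ℕ) (s : ℕ → Fin 11),
      MeasurableSet {ω : ℤ → Fin 11 | ∀ i : ℕ, i ≤ k → ω (n - i) = s i} := by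
    intro n k s
    simp only [ofPred_forall]
    exact MeasurableSet.iInter fun i => MeasurableSet.iInter fun _ => hcoord _ _
  refine ⟨Q.map measurable_decode.aemeasurable, isUST_map hQ, ?_,
    fun t ht n => ⟨existsUnique_gamma ht n, symbol_Y ht n⟩, ?_, fun n k => ?_,
    fun ν hν => vecMul_R_eq_iff hν, chainEntropy_invDist⟩
  · rw [hP]
    exact (ae_map_iff (p := fun t => t ∈ spanningTrees) measurable_decode.aemeasurable
      measurableSet_spanningTrees).2 (hgood.mono fun ω h => h.1)
  · rw [hP]
    refine ⟨measurable_Y, R_mem_rowStochastic, fun k => ?_, fun n k s j => ?_⟩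
    · have hm : Measurable fun (ω : ℤ → Fin 11) (n : ℤ) => ω (n + k) :=
        measurable_pi_lambda _ fun n => measurable_pi_apply (n + k)
      have := Measure.map_map (μ := (Q : Measure (ℤ → Fin 11)).map decode) hm hY
      rw [hmap, hlaw.map_shift] at this
      rw [hmap]
      exact this.symm
    · exact (hreal _ ((hcoord (n + 1) j).inter (hcyl n k s))).trans
        ((hlaw.markov n k s j).trans (congrArg (· * R (s 0) j) (hreal _ (hcyl n k s)).symm))
  · rw [hP, ← hlaw.real_eq n k, ← hreal _ (hcoord n k)]
    rfl
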